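/- Let $n\ge 3$ be an integer and let $p>1$ be a real number. A convex body is a nonempty compact convex subset of $\mathbb R^n$, and $\mathcal K^n_o$ denotes the set of convex bodies in $\mathbb R^n$ that contain the origin, equipped with the Hausdorff metric. A convex body $K$ is determined by its support function $h(K,u)=\max_{x\in K}\langle x,u\rangle$, $u\in\mathbb R^n$. For $K,L\in\mathcal K^n_o$ the $L_p$-Minkowski sum $K+_pL\in\mathcal K^n_o$ is defined by $$h(K+_pL,u)^p=h(K,u)^p+h(L,u)^p,\qquad u\in\mathbb R^n,$$ and the asymmetric $L_p$-moment bodies $M_p^{+}K,\,M_p^{-}K\in\mathcal K^n_o$ are defined by $$h(M_p^{\pm}K,u)^p=\int_K\langle x,u\rangle_{\pm}^p\,dx,\qquad u\in\mathbb R^n,$$ where $t_+=\max(0,t)$ and $t_-=\max(0,-t)$. Furthermore $cK=\{cx:x\in K\}$ for $c\ge 0$ and $-K=\{-x:x\in K\}$. A map $\Phi:\mathcal K^n_o\to\mathcal K^n_o$ is called an $L_p$-Minkowski valuation if $$\Phi(K\cup L)+_p\Phi(K\cap L)=\Phi K+_p\Phi L$$ for all $K,L\in\mathcal K^n_o$ with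 $K\cup L,\,K\cap L\in\mathcal K^n_o$, and it is called $SL(n)$-covariant if $\Phi(\phi K)=\phi\,\Phi K$ for all $\phi\in SL(n)$ and $K\in\mathcal K^n_o$. Then a map $\Phi:\mathcal K^n_o\to\mathcal K^n_o$ is a continuous $SL(n)$-covariant $L_p$-Minkowski valuation if and only if there exist constants $c_1,c_2,c_3,c_4\ge 0$ such that $$\Phi K=c_1M_p^{+}K+_p c_2M_p^{-}K+_p c_3K+_p c_4(-K)$$ for all $K\in\mathcal K^n_o$. -/

import Mathlib

namespace LpMinkowski

noncomputable section

open scoped Pointwise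

/-- The set `𝒦ₒⁿ` of convex bodies (nonempty compact convex sets) in `ℝⁿ` that contain the origin.
It carries the Hausdorff metric, inherited from `ConvexBody`. -/
abbrev BodyO (n : ℕ) : Type :=
  {K : ConvexBody (EuclideanSpace ℝ (Fin n)) // (0 : EuclideanSpace ℝ (Fin n)) ∈ K}

/-- The underlying point set of a convex body containing the origin. -/
def BodyO.toSet {n : ℕ} (K : BodyO n) : Set (EuclideanSpace ℝ (Fin n)) := (K.1 : Set _)

/-- The support function `h(K, u) = max {⟨x, u⟩ : x ∈ K}`. -/
def supportFun {n : ℕ} (K : ConvexBody (EuclideanSpace ℝ (Fin n)))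
    (u : EuclideanSpace ℝ (Fin n)) : ℝ :=
  sSup ((fun x => inner ℝ x u) '' (K : Set (EuclideanSpace ℝ (Fin n))))

/-- The support function is an attained maximum. -/
theorem supportFun_isGreatest {n : ℕ} (K : ConvexBody (EuclideanSpace ℝ (Fin n)))
    (u : EuclideanSpace ℝ (Fin n)) :
    IsGreatest ((fun x => inner ℝ x u) '' (K : Set (EuclideanSpace ℝ (Fin n))))
      (supportFun K u) :=
  (K.isCompact.image (by fun_prop)).isGreatest_sSup (K.nonempty.image _)

theorem inner_le_supportFun {n : ℕ} (K : ConvexBody (EuclideanSpace ℝ (Fin n)))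
    {x : EuclideanSpace ℝ (Fin n)} (hx : x ∈ K) (u : EuclideanSpace ℝ (Fin n)) :
    inner ℝ x u ≤ supportFun K u :=
  (supportFun_isGreatest K u).2 ⟨x, hx, rfl⟩

theorem supportFun_nonneg {n : ℕ} (K : BodyO n) (u : EuclideanSpace ℝ (Fin n)) :
    0 ≤ supportFun K.1 u := by
  simpa using inner_le_supportFun K.1 K.2 u

theorem supportFun_add_le {n : ℕ} (K : ConvexBody (EuclideanSpace ℝ (Fin n)))
    (u v : EuclideanSpace ℝ (Fin n)) :
    supportFun K (u + v) ≤ supportFun K u + supportFun K v := by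
  obtain ⟨x, hx, h⟩ := (supportFun_isGreatest K (u + v)).1
  rw [← h]
  simp only [inner_add_right]
  exact add_le_add (inner_le_supportFun K hx u) (inner_le_supportFun K hx v)

theorem supportFun_smul {n : ℕ} (K : ConvexBody (EuclideanSpace ℝ (Fin n)))
    {s : ℝ} (hs : 0 < s) (u : EuclideanSpace ℝ (Fin n)) :
    supportFun K (s • u) = s * supportFun K u := by
  apply le_antisymm
  · obtain ⟨x, hx, h⟩ := (supportFun_isGreatest K (s • u)).1
    rw [← h]
    simp only [inner_smul_right]
    exact mul_le_mul_of_nonneg_left (inner_le_supportFun K hx u) hs.le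
  · obtain ⟨x, hx, h⟩ := (supportFun_isGreatest K u).1
    rw [← h]
    simpa only [inner_smul_right] using inner_le_supportFun K hx (s • u)

/-- A convex body is determined by its support function. -/
theorem supportFun_injective {n : ℕ} :
    Function.Injective (supportFun (n := n)) := by
  have key : ∀ K L : ConvexBody (EuclideanSpace ℝ (Fin n)), supportFun K = supportFun L →
      (K : Set (EuclideanSpace ℝ (Fin n))) ⊆ L := by
    intro K L h x hx
    by_contra hxL
    obtain ⟨f, a, h1, h2⟩ := geometric_hahn_banach_closed_point L.convex L.isClosed hxL
    obtain ⟨u, rfl⟩ := (InnerProductSpace.toDual ℝ (EuclideanSpace ℝ (Fin n))).surjective f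
    simp only [InnerProductSpace.toDual_apply_apply, real_inner_comm] at h1 h2
    obtain ⟨y, hy, hyu⟩ := (supportFun_isGreatest L u).1
    have h3 := inner_le_supportFun K hx u
    have h4 := h1 y hy
    rw [h, ← hyu] at h3
    simp only [real_inner_comm] at h3 h4 h2
    linarith
  intro K L h
  exact ConvexBody.ext (Set.Subset.antisymm (key K L h) (key L K h.symm))

/-- The set `{x : ⟨x, u⟩ ≤ h(u) for all u}`, for a nonnegative function `h`. If `h` is sublinear,
it is the unique convex body with support function `h`, see `supportFun_bodyOf`. -/
def bodyOf {n : ℕ} (h : EuclideanSpace ℝ (Fin n) → ℝ) (h0 : ∀ u, 0 ≤ h u) : BodyO n :=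
  ⟨{ carrier := {x | ∀ u, inner ℝ x u ≤ h u}
     convex' := by
      intro x hx y hy a b ha hb hab u
      have h1 := mul_le_mul_of_nonneg_left (hx u) ha
      have h2 := mul_le_mul_of_nonneg_left (hy u) hb
      have h3 : h u = a * h u + b * h u := by rw [← add_mul, hab, one_mul]
      rw [inner_add_left, real_inner_smul_left, real_inner_smul_left, h3]
      exact add_le_add h1 h2
     isCompact' := by
      apply Metric.isCompact_of_isClosed_isBounded
      · rw [Set.ofPred_forall]
        exact isClosed_iInter fun u => isClosed_le (by fun_prop) continuous_const
      · let b := EuclideanSpace.basisFun (Fin n) ℝ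
        refine isBounded_iff_forall_norm_le.2 ⟨∑ i, max (h (b i)) (h (-b i)), fun x hx => ?_⟩
        calc ‖x‖ = ‖∑ i, (inner ℝ (b i) x) • b i‖ := by rw [b.sum_repr']
          _ ≤ ∑ i, ‖(inner ℝ (b i) x) • b i‖ := norm_sum_le _ _
          _ ≤ ∑ i, max (h (b i)) (h (-b i)) := by
            refine Finset.sum_le_sum fun i _ => ?_
            rw [norm_smul, b.norm_eq_one, mul_one, Real.norm_eq_abs, abs_le]
            have h1 := hx (b i)
            have h2 := hx (-b i)
            rw [inner_neg_right] at h2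
            rw [real_inner_comm] at h1 h2
            exact ⟨by linarith [le_max_right (h (b i)) (h (-b i))], le_max_of_le_left h1⟩
     nonempty' := ⟨0, fun u => by simpa using h0 u⟩ },
   fun u => by simpa using h0 u⟩

/-- A nonnegative sublinear function is the support function of the associated body. -/
theorem supportFun_bodyOf {n : ℕ} (h : EuclideanSpace ℝ (Fin n) → ℝ) (h0 : ∀ u, 0 ≤ h u)
    (hadd : ∀ u v, h (u + v) ≤ h u + h v)
    (hsmul : ∀ s : ℝ, 0 < s → ∀ u, h (s • u) = s * h u)
    (u : EuclideanSpace ℝ (Fin n)) :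
    supportFun (bodyOf h h0).1 u = h u := by
  apply le_antisymm
  · obtain ⟨x, hx, hxu⟩ := (supportFun_isGreatest (bodyOf h h0).1 u).1
    rw [← hxu]
    exact hx u
  · have hz : h 0 = 0 := by
      have := hsmul 2 (by norm_num) 0
      rw [smul_zero] at this
      linarith
    suffices ∃ g : EuclideanSpace ℝ (Fin n) →ₗ[ℝ] ℝ, g u = h u ∧ ∀ x, g x ≤ h x by
      obtain ⟨g, hgu, hg⟩ := this
      obtain ⟨x, hx⟩ := (InnerProductSpace.toDual ℝ (EuclideanSpace ℝ (Fin n))).surjective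
        (LinearMap.toContinuousLinearMap g)
      have hxg : ∀ v, inner ℝ x v = g v := fun v => by
        rw [← InnerProductSpace.toDual_apply_apply, hx]; rfl
      rw [← hgu, ← hxg]
      exact inner_le_supportFun _ (fun v => by rw [hxg]; exact hg v) u
    by_cases hu : u = 0
    · exact ⟨0, by simp [hu, hz], fun x => by simpa using h0 x⟩
    · let f : EuclideanSpace ℝ (Fin n) →ₗ.[ℝ] ℝ := LinearPMap.mkSpanSingleton u (h u) hu
      obtain ⟨g, hg1, hg2⟩ := exists_extension_of_le_sublinear f h hsmul hadd (by
        rintro ⟨x, hx⟩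
        obtain ⟨c, rfl⟩ := Submodule.mem_span_singleton.1 hx
        have hfc : f ⟨c • u, hx⟩ = c * h u := LinearPMap.mkSpanSingleton'_apply _ _ _ _ _
        rw [hfc]
        rcases lt_trichotomy c 0 with hc | rfl | hc
        · exact (mul_nonpos_of_nonpos_of_nonneg hc.le (h0 u)).trans (h0 _)
        · simp [hz]
        · rw [hsmul c hc])
      refine ⟨g, ?_, hg2⟩
      exact (hg1 ⟨u, Submodule.mem_span_singleton_self u⟩).trans
        (LinearPMap.mkSpanSingleton'_apply_self _ _ _ _)

/-- `Lₚ`-Minkowski addition: `K +ₚ L` is the convex body whose support function satisfies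
`h(K +ₚ L, ·)ᵖ = h(K, ·)ᵖ + h(L, ·)ᵖ`. -/
def lpAdd {n : ℕ} (p : ℝ) (K L : BodyO n) : BodyO n :=
  bodyOf (fun u => (supportFun K.1 u ^ p + supportFun L.1 u ^ p) ^ (1 / p)) fun u =>
    Real.rpow_nonneg (add_nonneg (Real.rpow_nonneg (supportFun_nonneg K u) p)
      (Real.rpow_nonneg (supportFun_nonneg L u) p)) _

theorem supportFun_lpAdd {n : ℕ} {p : ℝ} (hp : 1 < p) (K L : BodyO n)
    (u : EuclideanSpace ℝ (Fin n)) :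
    supportFun (lpAdd p K L).1 u ^ p = supportFun K.1 u ^ p + supportFun L.1 u ^ p := by
  have hp0 : p ≠ 0 := by linarith
  have hpp : 0 ≤ p := by linarith
  have hK := supportFun_nonneg K
  have hL := supportFun_nonneg L
  rw [lpAdd, supportFun_bodyOf]
  · rw [← Real.rpow_mul (add_nonneg (Real.rpow_nonneg (hK u) p) (Real.rpow_nonneg (hL u) p)),
      one_div_mul_cancel hp0, Real.rpow_one]
  · intro u v
    have h1 := Real.Lp_add_le_of_nonneg (Finset.univ : Finset (Fin 2))
      (f := ![supportFun K.1 u, supportFun L.1 u]) (g := ![supportFun K.1 v, supportFun L.1 v])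
      hp.le (by intro i _; fin_cases i <;> simp [hK, hL])
      (by intro i _; fin_cases i <;> simp [hK, hL])
    simp only [Fin.sum_univ_two, Matrix.cons_val_zero, Matrix.cons_val_one] at h1
    refine le_trans (Real.rpow_le_rpow ?_ (add_le_add ?_ ?_) (by positivity)) h1
    · exact add_nonneg (Real.rpow_nonneg (hK _) p) (Real.rpow_nonneg (hL _) p)
    · exact Real.rpow_le_rpow (hK _) (supportFun_add_le _ _ _) hpp
    · exact Real.rpow_le_rpow (hL _) (supportFun_add_le _ _ _) hpp
  · intro s hs u
    rw [supportFun_smul _ hs, supportFun_smul _ hs, Real.mul_rpow hs.le (hK u),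
      Real.mul_rpow hs.le (hL u), ← mul_add, Real.mul_rpow (Real.rpow_nonneg hs.le p)
        (add_nonneg (Real.rpow_nonneg (hK u) p) (Real.rpow_nonneg (hL u) p)),
      ← Real.rpow_mul hs.le, mul_one_div_cancel hp0, Real.rpow_one]

theorem integral_rpow_nonneg {n : ℕ} (p : ℝ) (S : Set (EuclideanSpace ℝ (Fin n)))
    (f : EuclideanSpace ℝ (Fin n) → ℝ) :
    0 ≤ ∫ x in S, (max 0 (f x)) ^ p :=
  MeasureTheory.integral_nonneg fun _ => Real.rpow_nonneg (le_max_left _ _) p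

/-- The asymmetric `Lₚ`-moment body `Mₚ⁺ K`, with `h(Mₚ⁺ K, u)ᵖ = ∫_K ⟨x, u⟩₊ᵖ dx`. -/
def momentPlus {n : ℕ} (p : ℝ) (K : ConvexBody (EuclideanSpace ℝ (Fin n))) : BodyO n :=
  bodyOf (fun u => (∫ x in (K : Set (EuclideanSpace ℝ (Fin n))),
      (max 0 (inner ℝ x u)) ^ p) ^ (1 / p))
    fun _ => Real.rpow_nonneg (integral_rpow_nonneg p _ _) _

/-- The asymmetric `Lₚ`-moment body `Mₚ⁻ K`, with `h(Mₚ⁻ K, u)ᵖ = ∫_K ⟨x, u⟩₋ᵖ dx`,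
where `t₋ = max 0 (-t)`. -/
def momentMinus {n : ℕ} (p : ℝ) (K : ConvexBody (EuclideanSpace ℝ (Fin n))) : BodyO n :=
  bodyOf (fun u => (∫ x in (K : Set (EuclideanSpace ℝ (Fin n))),
      (max 0 (-inner ℝ x u)) ^ p) ^ (1 / p))
    fun _ => Real.rpow_nonneg (integral_rpow_nonneg p _ _) _

theorem integral_rpow_sublinear {n : ℕ} {p : ℝ} (hp : 1 < p)
    (K : ConvexBody (EuclideanSpace ℝ (Fin n)))
    (f : EuclideanSpace ℝ (Fin n) → ℝ) (f₁ f₂ : EuclideanSpace ℝ (Fin n) → ℝ)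
    (h1 : Continuous f₁) (h2 : Continuous f₂) (hf : Continuous f)
    (h : ∀ x, f x ≤ f₁ x + f₂ x) :
    (∫ x in (K : Set (EuclideanSpace ℝ (Fin n))), (max 0 (f x)) ^ p) ^ (1 / p) ≤
      (∫ x in (K : Set (EuclideanSpace ℝ (Fin n))), (max 0 (f₁ x)) ^ p) ^ (1 / p) +
      (∫ x in (K : Set (EuclideanSpace ℝ (Fin n))), (max 0 (f₂ x)) ^ p) ^ (1 / p) := by
  set μ := MeasureTheory.volume.restrict (K : Set (EuclideanSpace ℝ (Fin n)))
  have hp0 : 0 < p := by linarith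
  have hq0 : ENNReal.ofReal p ≠ 0 := by simpa using hp0
  have : MeasureTheory.IsFiniteMeasure μ :=
    ⟨by simpa [μ] using K.isCompact.measure_lt_top⟩
  have key : ∀ g : EuclideanSpace ℝ (Fin n) → ℝ, Continuous g →
      MeasureTheory.MemLp (fun x => max 0 (g x)) (ENNReal.ofReal p) μ ∧
      MeasureTheory.eLpNorm (fun x => max 0 (g x)) (ENNReal.ofReal p) μ =
        ENNReal.ofReal ((∫ x, (max 0 (g x)) ^ p ∂μ) ^ (1 / p)) := by
    intro g hg
    have hc : Continuous fun x => max 0 (g x) := continuous_const.max hg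
    have hm : MeasureTheory.MemLp (fun x => max 0 (g x)) (ENNReal.ofReal p) μ := by
      obtain ⟨C, hC⟩ := K.isCompact.exists_bound_of_continuousOn hc.continuousOn
      exact MeasureTheory.MemLp.of_bound hc.aestronglyMeasurable C
        (MeasureTheory.ae_restrict_of_forall_mem K.isClosed.measurableSet hC)
    refine ⟨hm, ?_⟩
    rw [hm.eLpNorm_eq_integral_rpow_norm hq0 ENNReal.ofReal_ne_top,
      ENNReal.toReal_ofReal hp0.le, one_div]
    simp only [Real.norm_eq_abs, abs_of_nonneg (le_max_left (0 : ℝ) _)]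
  have hn : ∀ g : EuclideanSpace ℝ (Fin n) → ℝ, 0 ≤ (∫ x, (max 0 (g x)) ^ p ∂μ) ^ (1 / p) :=
    fun g => Real.rpow_nonneg (integral_rpow_nonneg p _ _) _
  rw [← ENNReal.ofReal_le_ofReal_iff (add_nonneg (hn _) (hn _)),
    ENNReal.ofReal_add (hn _) (hn _), ← (key f hf).2, ← (key f₁ h1).2, ← (key f₂ h2).2]
  refine le_trans (MeasureTheory.eLpNorm_mono_real fun x => ?_)
    (MeasureTheory.eLpNorm_add_le (key f₁ h1).1.1 (key f₂ h2).1.1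
      (by simpa using hp.le))
  rw [Real.norm_eq_abs, abs_of_nonneg (le_max_left (0 : ℝ) _)]
  exact max_le (add_nonneg (le_max_left _ _) (le_max_left _ _))
    ((h x).trans (add_le_add (le_max_right _ _) (le_max_right _ _)))

theorem integral_rpow_homogeneous {n : ℕ} {p : ℝ} (hp : 1 < p)
    (S : Set (EuclideanSpace ℝ (Fin n))) (f : EuclideanSpace ℝ (Fin n) → ℝ) {s : ℝ} (hs : 0 < s) :
    (∫ x in S, (max 0 (s * f x)) ^ p) ^ (1 / p) =
      s * (∫ x in S, (max 0 (f x)) ^ p) ^ (1 / p) := by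
  have h1 : ∀ x, (max 0 (s * f x)) ^ p = s ^ p * (max 0 (f x)) ^ p := fun x => by
    rw [← Real.mul_rpow hs.le (le_max_left _ _), mul_max_of_nonneg _ _ hs.le, mul_zero]
  simp only [h1]
  rw [MeasureTheory.integral_const_mul,
    Real.mul_rpow (Real.rpow_nonneg hs.le p) (integral_rpow_nonneg p _ _),
    ← Real.rpow_mul hs.le, mul_one_div_cancel (by linarith), Real.rpow_one]

theorem supportFun_momentPlus {n : ℕ} {p : ℝ} (hp : 1 < p)
    (K : ConvexBody (EuclideanSpace ℝ (Fin n))) (u : EuclideanSpace ℝ (Fin n)) :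
    supportFun (momentPlus p K).1 u ^ p =
      ∫ x in (K : Set (EuclideanSpace ℝ (Fin n))), (max 0 (inner ℝ x u)) ^ p := by
  rw [momentPlus, supportFun_bodyOf]
  · rw [← Real.rpow_mul (integral_rpow_nonneg p _ _),
      one_div_mul_cancel (by linarith), Real.rpow_one]
  · intro u v
    exact integral_rpow_sublinear hp K _ _ _ (by fun_prop) (by fun_prop) (by fun_prop)
      fun x => (inner_add_right x u v).le
  · intro s hs u
    simp only [inner_smul_right]
    exact integral_rpow_homogeneous hp _ _ hs

theorem supportFun_momentMinus {n : ℕ} {p : ℝ} (hp : 1 < p)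
    (K : ConvexBody (EuclideanSpace ℝ (Fin n))) (u : EuclideanSpace ℝ (Fin n)) :
    supportFun (momentMinus p K).1 u ^ p =
      ∫ x in (K : Set (EuclideanSpace ℝ (Fin n))), (max 0 (-inner ℝ x u)) ^ p := by
  rw [momentMinus, supportFun_bodyOf]
  · rw [← Real.rpow_mul (integral_rpow_nonneg p _ _),
      one_div_mul_cancel (by linarith), Real.rpow_one]
  · intro u v
    exact integral_rpow_sublinear hp K _ _ _ (by fun_prop) (by fun_prop) (by fun_prop)
      fun x => by rw [inner_add_right, neg_add]
  · intro s hs u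
    simp only [inner_smul_right, ← mul_neg]
    exact integral_rpow_homogeneous hp _ _ hs

/-- The dilate `c K = {c x : x ∈ K}`. -/
def scale {n : ℕ} (c : ℝ) (K : BodyO n) : BodyO n :=
  ⟨c • K.1, ⟨0, K.2, smul_zero c⟩⟩

/-- The reflection `-K = {-x : x ∈ K}`. -/
def reflect {n : ℕ} (K : BodyO n) : BodyO n :=
  ⟨⟨-(K.1 : Set (EuclideanSpace ℝ (Fin n))), K.1.convex.neg, K.1.isCompact.neg,
    K.1.nonempty.neg⟩, by
      change (0 : EuclideanSpace ℝ (Fin n)) ∈ -(K.1 : Set (EuclideanSpace ℝ (Fin n)))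
      simpa using K.2⟩

/-- The linear image `φ K` for `φ ∈ SL(n)`. -/
def slImage {n : ℕ} (φ : Matrix.SpecialLinearGroup (Fin n) ℝ) (K : BodyO n) : BodyO n :=
  ⟨⟨Matrix.toEuclideanCLM (𝕜 := ℝ) φ.1 '' (K.1 : Set (EuclideanSpace ℝ (Fin n))),
    K.1.convex.linear_image (Matrix.toEuclideanCLM (𝕜 := ℝ) φ.1).toLinearMap,
    K.1.isCompact.image (Matrix.toEuclideanCLM (𝕜 := ℝ) φ.1).continuous,
    K.1.nonempty.image _⟩, ⟨0, K.2, map_zero _⟩⟩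

/-- `Φ` is `SL(n)`-covariant: `Φ (φ K) = φ (Φ K)`. -/
def IsSLCovariant {n : ℕ} (Φ : BodyO n → BodyO n) : Prop :=
  ∀ (φ : Matrix.SpecialLinearGroup (Fin n) ℝ) (K : BodyO n), Φ (slImage φ K) = slImage φ (Φ K)

/-- `Φ` is an `Lₚ`-Minkowski valuation on `𝒦ₒⁿ`: `Φ (K ∪ L) +ₚ Φ (K ∩ L) = Φ K +ₚ Φ L` whenever
`K`, `L`, `K ∪ L` and `K ∩ L` all belong to `𝒦ₒⁿ`. -/
def IsLpMinkowskiValuation {n : ℕ} (p : ℝ) (Φ : BodyO n → BodyO n) : Prop :=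
  ∀ K L U I : BodyO n, U.toSet = K.toSet ∪ L.toSet → I.toSet = K.toSet ∩ L.toSet →
    lpAdd p (Φ U) (Φ I) = lpAdd p (Φ K) (Φ L)

end

end LpMinkowski

namespace LpMinkowski

noncomputable section

open scoped Pointwise
open Filter Topology MeasureTheory

/-! Put f(K, u) = h(ΦK, u)^p. Taking `p`-th powers turns the Lₚ-sum into ordinary addition, so Φ has
the three required properties exactly when f is an `IsLpFunctional`: a real valuation in K for each
u, continuous in K and in u, compatible with SL(n), and homogeneous of degree `p` in u. No sign is
imposed there, so differences of such functionals are again such functionals, and the classification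
becomes linear algebra in a space of dimension four.

The core is uniqueness (`IsLpFunctional.eq_zero`). Let e be a basis vector and T the standard
simplex. A functional that vanishes on the segment [0, e] and on T in the directions ±e is zero. By
continuity it suffices to treat polytopes. Hyperplanes through the origin cut these into simplices
with a vertex at the origin (`IsVal.eq_zero_of_simplexBody`). The cuts never leave the class of
bodies containing 0.

On a simplex with edge vectors b from the origin, covariance leaves dependence only on det b and the
numbers ⟨bᵢ, u⟩ (`apply_restr_congr`). Cutting through an edge [bᵢ, bⱼ] at a point orthogonal to u
lowers the number of nonvanishing pairings, so one may assume that u vanishes on all vectors but one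
(`apply_eq_zero_of_single`). Three cases remain. A segment is moved to the standard one. A simplex
of intermediate dimension has an edge orthogonal to u that can be shrunk to 0 at constant
determinant. A full simplex has, because n ≥ 3, two vertices orthogonal to u; cutting the edge
between them gives Cauchy's functional equation in the determinant, so continuity makes the value
linear in it and T decides.

For existence, the moment functionals vanish on [0, e] while the `p`-th powers of h(K, ±u) do not,
so the four standard functionals can match any four prescribed values. The coefficients of the
latter are values of f on the segment, hence nonnegative; those of the former are nonnegative
because on the dilates sT the moment grows like s^(n+p), against s^p for the support function. -/

/-- Euclidean space `ℝⁿ`. -/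
abbrev Euc (n : ℕ) : Type := EuclideanSpace ℝ (Fin n)

/-! ### Support functions and the Hausdorff metric -/

theorem supportFun_le {n : ℕ} {K : ConvexBody (Euc n)} {u : Euc n} {c : ℝ}
    (h : ∀ x ∈ K, inner ℝ x u ≤ c) : supportFun K u ≤ c := by
  obtain ⟨x, hx, hxu⟩ := (supportFun_isGreatest K u).1
  rw [← hxu]
  exact h x hx

theorem exists_inner_eq_supportFun {n : ℕ} (K : ConvexBody (Euc n)) (u : Euc n) :
    ∃ x ∈ K, inner ℝ x u = supportFun K u :=
  (supportFun_isGreatest K u).1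

theorem supportFun_le_add_dist {n : ℕ} (K L : ConvexBody (Euc n)) (u : Euc n) :
    supportFun K u ≤ supportFun L u + dist K L * ‖u‖ := by
  refine supportFun_le fun x hx => ?_
  obtain ⟨y, hy, hxy⟩ := L.isCompact.exists_infDist_eq_dist L.nonempty x
  have h1 : dist x y ≤ dist K L := by
    rw [← hxy, ← ConvexBody.hausdorffDist_coe]
    exact Metric.infDist_le_hausdorffDist_of_mem hx ConvexBody.hausdorffEDist_ne_top
  calc inner ℝ x u = inner ℝ y u + inner ℝ (x - y) u := by rw [inner_sub_left]; ring
    _ ≤ supportFun L u + ‖x - y‖ * ‖u‖ :=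
      add_le_add (inner_le_supportFun L hy u) (real_inner_le_norm _ _)
    _ ≤ _ := by
      rw [← dist_eq_norm]
      gcongr

theorem abs_supportFun_sub_le {n : ℕ} (K L : ConvexBody (Euc n)) (u : Euc n) :
    |supportFun K u - supportFun L u| ≤ dist K L * ‖u‖ := by
  have h1 := supportFun_le_add_dist K L u
  have h2 := supportFun_le_add_dist L K u
  rw [dist_comm] at h2
  rw [abs_le]
  constructor <;> linarith

/-- The direction is the normalised difference of x and its nearest point y in L. It gives
separation with the exact gap dist x y, which converts support function estimates into distance
estimates. -/
theorem exists_separating_direction {n : ℕ} (L : ConvexBody (Euc n)) {x : Euc n} (hx : x ∉ L) :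
    ∃ u : Euc n, ‖u‖ = 1 ∧ ∃ y ∈ L, supportFun L u + dist x y ≤ inner ℝ x u := by
  obtain ⟨y, hy, hxy⟩ := exists_norm_eq_iInf_of_complete_convex L.nonempty
    L.isCompact.isComplete L.convex x
  rw [norm_eq_iInf_iff_real_inner_le_zero L.convex hy] at hxy
  have hne : x - y ≠ 0 := fun h => hx (by rw [sub_eq_zero.1 h]; exact hy)
  have hpos : 0 < ‖x - y‖ := norm_pos_iff.2 hne
  refine ⟨‖x - y‖⁻¹ • (x - y), norm_smul_inv_norm hne, y, hy, ?_⟩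
  have h1 : supportFun L (‖x - y‖⁻¹ • (x - y)) ≤ inner ℝ y (‖x - y‖⁻¹ • (x - y)) := by
    refine supportFun_le fun z hz => ?_
    have h2 := hxy z hz
    rw [real_inner_comm, inner_sub_left] at h2
    rw [inner_smul_right, inner_smul_right]
    gcongr
    linarith
  have h3 : inner ℝ x (‖x - y‖⁻¹ • (x - y)) = inner ℝ y (‖x - y‖⁻¹ • (x - y)) + ‖x - y‖ := by
    have h4 : inner ℝ (x - y) (‖x - y‖⁻¹ • (x - y)) = ‖x - y‖ := by
      rw [inner_smul_right, real_inner_self_eq_norm_sq]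
      field_simp
    rw [inner_sub_left] at h4
    linarith
  rw [h3, dist_eq_norm]
  linarith

/-- A point of one body outside the other is separated from its nearest point by a unit vector along
which the support functions differ by at least that distance. -/
theorem dist_le_of_supportFun {n : ℕ} {K L : ConvexBody (Euc n)} {ε : ℝ} (hε : 0 ≤ ε)
    (h : ∀ u : Euc n, ‖u‖ = 1 → |supportFun K u - supportFun L u| ≤ ε) : dist K L ≤ ε := by
  have key : ∀ K L : ConvexBody (Euc n),
      (∀ u : Euc n, ‖u‖ = 1 → |supportFun K u - supportFun L u| ≤ ε) →
      ∀ x ∈ (K : Set (Euc n)), ∃ y ∈ (L : Set (Euc n)), dist x y ≤ ε := by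
    intro K L h x hx
    by_cases hxL : x ∈ L
    · exact ⟨x, hxL, by simpa using hε⟩
    · obtain ⟨u, hu, y, hy, hxy⟩ := exists_separating_direction L hxL
      have h1 := inner_le_supportFun K hx u
      have h2 := (abs_le.1 (h u hu)).2
      exact ⟨y, hy, by linarith⟩
  rw [← ConvexBody.hausdorffDist_coe]
  refine Metric.hausdorffDist_le_of_mem_dist hε (key K L h) (key L K fun u hu => ?_)
  rw [abs_sub_comm]
  exact h u hu

theorem supportFun_le_of_subset_closedBall {n : ℕ} {K : ConvexBody (Euc n)} {R : ℝ}
    (h : ∀ x ∈ K, ‖x‖ ≤ R) (u : Euc n) : supportFun K u ≤ R * ‖u‖ :=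
  supportFun_le fun x hx => (real_inner_le_norm x u).trans (by gcongr; exact h x hx)

theorem abs_supportFun_sub_le_of_bound {n : ℕ} {K : ConvexBody (Euc n)} {R : ℝ}
    (h : ∀ x ∈ K, ‖x‖ ≤ R) (u v : Euc n) :
    |supportFun K u - supportFun K v| ≤ R * ‖u - v‖ := by
  have h1 := supportFun_add_le K (u - v) v
  have h2 := supportFun_add_le K (v - u) u
  have h3 := supportFun_le_of_subset_closedBall h (u - v)
  have h4 := supportFun_le_of_subset_closedBall h (v - u)
  rw [sub_add_cancel] at h1 h2
  rw [norm_sub_rev] at h4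
  rw [abs_le]
  constructor <;> linarith

theorem exists_norm_le {n : ℕ} (K : ConvexBody (Euc n)) : ∃ R : ℝ, 0 ≤ R ∧ ∀ x ∈ K, ‖x‖ ≤ R := by
  obtain ⟨R, hR⟩ := K.isCompact.isBounded.exists_norm_le
  obtain ⟨x, hx⟩ := K.nonempty
  exact ⟨R, (norm_nonneg x).trans (hR x hx), hR⟩

theorem continuous_supportFun {n : ℕ} (K : ConvexBody (Euc n)) : Continuous (supportFun K) := by
  obtain ⟨R, hR0, hR⟩ := exists_norm_le K
  refine (LipschitzWith.of_dist_le_mul (K := ⟨R, hR0⟩) fun u v => ?_).continuous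
  rw [Real.dist_eq, dist_eq_norm]
  exact abs_supportFun_sub_le_of_bound hR u v

theorem continuous_supportFun_body {n : ℕ} (u : Euc n) :
    Continuous fun K : BodyO n => supportFun K.1 u := by
  refine (LipschitzWith.of_dist_le_mul (K := ⟨‖u‖, norm_nonneg u⟩) fun K L => ?_).continuous
  rw [Real.dist_eq, mul_comm]
  exact abs_supportFun_sub_le K.1 L.1 u

theorem norm_le_sum_supportFun {n : ℕ} (K : BodyO n) {x : Euc n} (hx : x ∈ K.1) :
    ‖x‖ ≤ ∑ i, (supportFun K.1 (EuclideanSpace.basisFun (Fin n) ℝ i) +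
      supportFun K.1 (-EuclideanSpace.basisFun (Fin n) ℝ i)) := by
  set b := EuclideanSpace.basisFun (Fin n) ℝ
  calc ‖x‖ = ‖∑ i, (inner ℝ (b i) x) • b i‖ := by rw [b.sum_repr']
    _ ≤ ∑ i, ‖(inner ℝ (b i) x) • b i‖ := norm_sum_le _ _
    _ ≤ _ := by
      refine Finset.sum_le_sum fun i _ => ?_
      rw [norm_smul, b.norm_eq_one, mul_one, Real.norm_eq_abs, abs_le]
      have h1 := inner_le_supportFun K.1 hx (b i)
      have h2 := inner_le_supportFun K.1 hx (-b i)
      have h3 := supportFun_nonneg K (b i)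
      have h4 := supportFun_nonneg K (-b i)
      rw [inner_neg_right] at h2
      rw [real_inner_comm] at h1 h2
      constructor <;> linarith

/-- A map into convex bodies is continuous as soon as all support functions are. -/
theorem continuous_of_supportFun {n : ℕ} {X : Type*} [TopologicalSpace X] {Φ : X → BodyO n}
    (h : ∀ u, Continuous fun x => supportFun (Φ x).1 u) : Continuous Φ := by
  rw [continuous_iff_continuousAt]
  intro x₀
  rw [ContinuousAt, Metric.tendsto_nhds]
  intro ε hε
  set B : X → ℝ := fun x => ∑ i, (supportFun (Φ x).1 (EuclideanSpace.basisFun (Fin n) ℝ i) +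
      supportFun (Φ x).1 (-EuclideanSpace.basisFun (Fin n) ℝ i)) with hB
  have hBc : Continuous B := continuous_finsetSum _ fun i _ => (h _).add (h _)
  have hB0 : ∀ x, 0 ≤ B x := fun x => Finset.sum_nonneg fun i _ =>
    add_nonneg (supportFun_nonneg _ _) (supportFun_nonneg _ _)
  set R := B x₀ + 1 with hR
  have hR0 : 0 < R := by have := hB0 x₀; linarith
  have hev : ∀ᶠ x in 𝓝 x₀, B x < R := hBc.continuousAt.eventually_lt_const (by simp [hR])
  have hδ : 0 < ε / (8 * R) := by positivity
  -- A finite net makes pointwise convergence uniform on the sphere: near x₀ all bodies lie in the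
  -- ball of radius R, so their support functions are R-Lipschitz, and the errors ε/8, ε/4, ε/8 add
  -- up to ε/2.
  obtain ⟨t, -, htf, ht⟩ := (isCompact_sphere (0 : Euc n) 1).finite_cover_balls hδ
  have hev2 : ∀ᶠ x in 𝓝 x₀, ∀ v ∈ t,
      |supportFun (Φ x).1 v - supportFun (Φ x₀).1 v| < ε / 4 := by
    rw [Filter.eventually_all_finite htf]
    intro v _
    have := (h v).continuousAt (x := x₀)
    rw [ContinuousAt, Metric.tendsto_nhds] at this
    simpa only [Real.dist_eq] using this (ε / 4) (by positivity)
  filter_upwards [hev, hev2] with x hx hx2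
  have hb : ∀ x, B x < R → ∀ y ∈ (Φ x).1, ‖y‖ ≤ R := fun x hx y hy =>
    (norm_le_sum_supportFun (Φ x) hy).trans hx.le
  refine lt_of_le_of_lt (b := ε / 2) ?_ (by linarith)
  refine dist_le_of_supportFun (by positivity) fun u hu => ?_
  have hu' : u ∈ Metric.sphere (0 : Euc n) 1 := by simpa using hu
  obtain ⟨v, hv, huv⟩ := Set.mem_iUnion₂.1 (ht hu')
  rw [Metric.mem_ball, dist_eq_norm] at huv
  have h1 := abs_supportFun_sub_le_of_bound (hb x hx) u v
  have h2 := abs_supportFun_sub_le_of_bound (hb x₀ (by simp [hR])) u v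
  have h3 := hx2 v hv
  have h4 : R * ‖u - v‖ ≤ ε / 8 := by
    calc R * ‖u - v‖ ≤ R * (ε / (8 * R)) := by gcongr
      _ = ε / 8 := by field_simp
  rw [abs_le] at *
  rw [abs_lt] at h3
  constructor <;> linarith

theorem BodyO.ext_toSet {n : ℕ} {K L : BodyO n} (h : K.toSet = L.toSet) : K = L :=
  Subtype.ext (ConvexBody.ext h)

theorem BodyO.ext_supportFun_rpow {n : ℕ} {p : ℝ} (hp : 1 < p) {K L : BodyO n}
    (h : ∀ u, supportFun K.1 u ^ p = supportFun L.1 u ^ p) : K = L := by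
  refine Subtype.ext (supportFun_injective (funext fun u => ?_))
  have := h u
  rwa [Real.rpow_left_inj (supportFun_nonneg _ _) (supportFun_nonneg _ _) (by linarith)] at this

/-- The adjoint action of `φ` on directions. -/
def slAdj {n : ℕ} (φ : Matrix.SpecialLinearGroup (Fin n) ℝ) (u : Euc n) : Euc n :=
  ContinuousLinearMap.adjoint (Matrix.toEuclideanCLM (𝕜 := ℝ) φ.1) u

theorem inner_slAdj {n : ℕ} (φ : Matrix.SpecialLinearGroup (Fin n) ℝ) (x u : Euc n) :
    inner ℝ x (slAdj φ u) = inner ℝ (Matrix.toEuclideanCLM (𝕜 := ℝ) φ.1 x) u :=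
  ContinuousLinearMap.adjoint_inner_right _ _ _

theorem supportFun_slImage {n : ℕ} (φ : Matrix.SpecialLinearGroup (Fin n) ℝ) (K : BodyO n)
    (u : Euc n) : supportFun (slImage φ K).1 u = supportFun K.1 (slAdj φ u) := by
  apply le_antisymm
  · refine supportFun_le fun x hx => ?_
    obtain ⟨y, hy, rfl⟩ := hx
    rw [← inner_slAdj]
    exact inner_le_supportFun K.1 hy _
  · refine supportFun_le fun x hx => ?_
    rw [inner_slAdj]
    exact inner_le_supportFun (slImage φ K).1 ⟨x, hx, rfl⟩ _

theorem supportFun_scale {n : ℕ} {c : ℝ} (hc : 0 ≤ c) (K : BodyO n) (u : Euc n) :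
    supportFun (scale c K).1 u = c * supportFun K.1 u := by
  apply le_antisymm
  · refine supportFun_le fun x hx => ?_
    obtain ⟨y, hy, rfl⟩ := hx
    change inner ℝ (c • y) u ≤ _
    rw [real_inner_smul_left]
    exact mul_le_mul_of_nonneg_left (inner_le_supportFun K.1 hy u) hc
  · obtain ⟨x, hx, hxu⟩ := exists_inner_eq_supportFun K.1 u
    rw [← hxu, ← real_inner_smul_left]
    exact inner_le_supportFun (scale c K).1 ⟨x, hx, rfl⟩ u

theorem supportFun_reflect {n : ℕ} (K : BodyO n) (u : Euc n) :
    supportFun (reflect K).1 u = supportFun K.1 (-u) := by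
  apply le_antisymm
  · refine supportFun_le fun x hx => ?_
    have hx' : -x ∈ K.1 := hx
    simpa using inner_le_supportFun K.1 hx' (-u)
  · refine supportFun_le fun x hx => ?_
    have hx' : -x ∈ (reflect K).1 := by
      change - -x ∈ K.1
      simpa using hx
    simpa using inner_le_supportFun (reflect K).1 hx' u

theorem supportFun_union {n : ℕ} {K L U : BodyO n} (h : U.toSet = K.toSet ∪ L.toSet) (u : Euc n) :
    supportFun U.1 u = max (supportFun K.1 u) (supportFun L.1 u) := by
  apply le_antisymm
  · refine supportFun_le fun x hx => ?_
    have hx' : x ∈ K.toSet ∪ L.toSet := h ▸ hx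
    rcases hx' with hx' | hx'
    · exact le_max_of_le_left (inner_le_supportFun K.1 hx' u)
    · exact le_max_of_le_right (inner_le_supportFun L.1 hx' u)
  · refine max_le (supportFun_le fun x hx => ?_) (supportFun_le fun x hx => ?_) <;>
    refine inner_le_supportFun U.1 ?_ u
    · exact (h ▸ Or.inl hx : x ∈ U.toSet)
    · exact (h ▸ Or.inr hx : x ∈ U.toSet)

/-- The segment joining maximisers x ∈ K and y ∈ L lies in the convex set K ∪ L. Being connected, it
meets K ∩ L, and there the pairing with u is a convex combination of the two maxima. -/
theorem supportFun_inter {n : ℕ} {K L U I : BodyO n} (h : U.toSet = K.toSet ∪ L.toSet)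
    (h' : I.toSet = K.toSet ∩ L.toSet) (u : Euc n) :
    supportFun I.1 u = min (supportFun K.1 u) (supportFun L.1 u) := by
  apply le_antisymm
  · refine supportFun_le fun x hx => ?_
    have hx' : x ∈ K.toSet ∩ L.toSet := h' ▸ hx
    exact le_min (inner_le_supportFun K.1 hx'.1 u) (inner_le_supportFun L.1 hx'.2 u)
  · obtain ⟨x, hx, hxu⟩ := exists_inner_eq_supportFun K.1 u
    obtain ⟨y, hy, hyu⟩ := exists_inner_eq_supportFun L.1 u
    have hxU : x ∈ U.toSet := h ▸ Or.inl hx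
    have hyU : y ∈ U.toSet := h ▸ Or.inr hy
    have hseg : segment ℝ x y ⊆ K.toSet ∪ L.toSet := h ▸ U.1.convex.segment_subset hxU hyU
    obtain ⟨z, hz, hzI⟩ := isPreconnected_closed_iff.1 (convex_segment x y).isPreconnected
      K.toSet L.toSet K.1.isClosed L.1.isClosed hseg ⟨x, left_mem_segment ℝ x y, hx⟩
      ⟨y, right_mem_segment ℝ x y, hy⟩
    have hzI' : z ∈ I.toSet := h' ▸ hzI
    refine le_trans ?_ (inner_le_supportFun I.1 hzI' u)
    obtain ⟨a, b, ha, hb, hab, rfl⟩ := hz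
    rw [inner_add_left, real_inner_smul_left, real_inner_smul_left, hxu, hyu]
    calc min (supportFun K.1 u) (supportFun L.1 u)
        = a * min (supportFun K.1 u) (supportFun L.1 u) +
          b * min (supportFun K.1 u) (supportFun L.1 u) := by rw [← add_mul, hab, one_mul]
      _ ≤ _ := by
        gcongr
        · exact min_le_left _ _
        · exact min_le_right _ _

/-! ### Functionals of degree `p` -/

/-- Continuous, `SL(n)`-covariant real valuations depending `p`-homogeneously on a direction. -/
structure IsLpFunctional {n : ℕ} (p : ℝ) (g : BodyO n → Euc n → ℝ) : Prop where
  cont : ∀ u, Continuous fun K => g K u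
  cont_dir : ∀ K, Continuous (g K)
  cov : ∀ φ K u, g (slImage φ K) u = g K (slAdj φ u)
  hom : ∀ K, ∀ c : ℝ, 0 < c → ∀ u, g K (c • u) = c ^ p * g K u
  val : ∀ K L U I : BodyO n, U.toSet = K.toSet ∪ L.toSet → I.toSet = K.toSet ∩ L.toSet →
    ∀ u, g U u + g I u = g K u + g L u

namespace IsLpFunctional

variable {n : ℕ} {p : ℝ} {g g' : BodyO n → Euc n → ℝ}

theorem add (h : IsLpFunctional p g) (h' : IsLpFunctional p g') :
    IsLpFunctional p fun K u => g K u + g' K u where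
  cont u := (h.cont u).add (h'.cont u)
  cont_dir K := (h.cont_dir K).add (h'.cont_dir K)
  cov φ K u := by rw [h.cov, h'.cov]
  hom K c hc u := by rw [h.hom K c hc, h'.hom K c hc]; ring
  val K L U I hU hI u := by linarith [h.val K L U I hU hI u, h'.val K L U I hU hI u]

theorem const_mul (h : IsLpFunctional p g) (a : ℝ) : IsLpFunctional p fun K u => a * g K u where
  cont u := (h.cont u).const_mul a
  cont_dir K := (h.cont_dir K).const_mul a
  cov φ K u := by rw [h.cov]
  hom K c hc u := by rw [h.hom K c hc]; ring
  val K L U I hU hI u := by rw [← mul_add, ← mul_add, h.val K L U I hU hI u]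

theorem comp_neg (h : IsLpFunctional p g) : IsLpFunctional p fun K u => g K (-u) where
  cont u := h.cont (-u)
  cont_dir K := (h.cont_dir K).comp continuous_neg
  cov φ K u := by rw [h.cov, slAdj, slAdj, map_neg]
  hom K c hc u := by rw [← smul_neg, h.hom K c hc]
  val K L U I hU hI u := h.val K L U I hU hI (-u)

theorem apply_zero (h : IsLpFunctional p g) (hp : 1 < p) (K : BodyO n) : g K 0 = 0 := by
  have h1 := h.hom K 2 (by norm_num) 0
  rw [smul_zero] at h1
  have h2 : (1 : ℝ) < 2 ^ p := Real.one_lt_rpow (by norm_num) (by linarith)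
  have h3 : (2 ^ p - 1) * g K 0 = 0 := by linarith
  rcases mul_eq_zero.1 h3 with h4 | h4
  · linarith
  · exact h4

end IsLpFunctional

theorem continuous_rpow_const_of_one_lt {p : ℝ} (hp : 1 < p) : Continuous fun t : ℝ => t ^ p :=
  Real.continuous_rpow_const (by linarith)

theorem isLpFunctional_supportFun {n : ℕ} {p : ℝ} (hp : 1 < p) :
    IsLpFunctional (n := n) p fun K u => supportFun K.1 u ^ p where
  cont u := (continuous_rpow_const_of_one_lt hp).comp (continuous_supportFun_body u)
  cont_dir K := (continuous_rpow_const_of_one_lt hp).comp (continuous_supportFun K.1)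
  cov φ K u := by rw [supportFun_slImage]
  hom K c hc u := by rw [supportFun_smul K.1 hc, Real.mul_rpow hc.le (supportFun_nonneg K u)]
  val K L U I hU hI u := by
    rw [supportFun_union hU, supportFun_inter hU hI]
    rcases le_total (supportFun K.1 u) (supportFun L.1 u) with h | h
    · rw [max_eq_right h, min_eq_left h, add_comm]
    · rw [max_eq_left h, min_eq_right h]

/-- The `p`-th power of the support function of a continuous, covariant `Lₚ`-Minkowski valuation. -/
theorem isLpFunctional_of_valuation {n : ℕ} {p : ℝ} (hp : 1 < p) {Φ : BodyO n → BodyO n}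
    (hc : Continuous Φ) (hs : IsSLCovariant Φ) (hv : IsLpMinkowskiValuation p Φ) :
    IsLpFunctional p fun K u => supportFun (Φ K).1 u ^ p where
  cont u := ((isLpFunctional_supportFun hp).cont u).comp hc
  cont_dir K := (isLpFunctional_supportFun hp).cont_dir (Φ K)
  cov φ K u := by rw [hs, supportFun_slImage]
  hom K := (isLpFunctional_supportFun hp).hom (Φ K)
  val K L U I hU hI u := by
    rw [← supportFun_lpAdd hp, ← supportFun_lpAdd hp, hv K L U I hU hI]

/-- Conversely, a map whose support functions yield a functional of degree `p` is a continuous,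
covariant `Lₚ`-Minkowski valuation. -/
theorem valuation_of_isLpFunctional {n : ℕ} {p : ℝ} (hp : 1 < p) {Φ : BodyO n → BodyO n}
    (h : IsLpFunctional p fun K u => supportFun (Φ K).1 u ^ p) :
    Continuous Φ ∧ IsSLCovariant Φ ∧ IsLpMinkowskiValuation p Φ := by
  refine ⟨continuous_of_supportFun fun u => ?_, fun φ K => ?_, fun K L U I hU hI => ?_⟩
  · have h1 : (fun K => supportFun (Φ K).1 u) = fun K => (supportFun (Φ K).1 u ^ p) ^ (1 / p) := by
      funext K
      rw [← Real.rpow_mul (supportFun_nonneg _ _), mul_one_div_cancel (by linarith), Real.rpow_one]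
    rw [h1]
    exact (Real.continuous_rpow_const (by positivity)).comp (h.cont u)
  · refine BodyO.ext_supportFun_rpow hp fun u => ?_
    rw [h.cov, supportFun_slImage]
  · refine BodyO.ext_supportFun_rpow hp fun u => ?_
    rw [supportFun_lpAdd hp, supportFun_lpAdd hp]
    exact h.val K L U I hU hI u

/-! ### Simplices with a vertex at the origin -/

/-- The simplex `conv {0, v₀, …, vₙ₋₁}`; some of the vectors `vᵢ` may vanish. -/
def simplexBody {n : ℕ} (v : Fin n → Euc n) : BodyO n :=
  ⟨{ carrier := {x | ∃ t : Fin n → ℝ, (∀ i, 0 ≤ t i) ∧ ∑ i, t i ≤ 1 ∧ x = ∑ i, t i • v i}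
     convex' := by
      rintro x ⟨t, ht, ht1, rfl⟩ y ⟨s, hs, hs1, rfl⟩ a b ha hb hab
      refine ⟨fun i => a * t i + b * s i, fun i => by
        have := ht i; have := hs i; positivity, ?_, ?_⟩
      · rw [Finset.sum_add_distrib, ← Finset.mul_sum, ← Finset.mul_sum]
        nlinarith
      · simp only [add_smul, mul_smul, Finset.sum_add_distrib, Finset.smul_sum]
     isCompact' := by
      have hc : IsCompact {t : Fin n → ℝ | (∀ i, 0 ≤ t i) ∧ ∑ i, t i ≤ 1} := by
        refine IsCompact.of_isClosed_subset
          (isCompact_univ_pi fun _ : Fin n => isCompact_Icc (a := (0 : ℝ)) (b := 1)) ?_ ?_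
        · have h1 : IsClosed {t : Fin n → ℝ | ∀ i, 0 ≤ t i} := by
            rw [Set.ofPred_forall]
            exact isClosed_iInter fun i => isClosed_le continuous_const (by fun_prop)
          have h2 : IsClosed {t : Fin n → ℝ | ∑ i, t i ≤ 1} :=
            isClosed_le (by fun_prop) continuous_const
          exact h1.inter h2
        · rintro t ⟨ht, ht1⟩ i -
          exact ⟨ht i, (Finset.single_le_sum (fun j _ => ht j) (Finset.mem_univ i)).trans ht1⟩
      convert hc.image (f := fun t : Fin n → ℝ => ∑ i, t i • v i) (by fun_prop) using 1
      ext x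
      constructor
      · rintro ⟨t, ht, ht1, rfl⟩
        exact ⟨t, ⟨ht, ht1⟩, rfl⟩
      · rintro ⟨t, ⟨ht, ht1⟩, rfl⟩
        exact ⟨t, ht, ht1, rfl⟩
     nonempty' := ⟨0, 0, by simp, by simp, by simp⟩ }, ⟨0, by simp, by simp, by simp⟩⟩

/-- Keeping the coefficients and moving the vertices displaces a point by at most the largest vertex
displacement. Degenerate vertices are allowed, so a simplex may collapse continuously onto a face.
-/
theorem continuous_simplexBody {n : ℕ} : Continuous (simplexBody (n := n)) := by
  have key : ∀ v w : Fin n → Euc n, ∀ x ∈ (simplexBody v).toSet,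
      ∃ y ∈ (simplexBody w).toSet, dist x y ≤ dist v w := by
    rintro v w _ ⟨t, ht, ht1, rfl⟩
    refine ⟨∑ i, t i • w i, ⟨t, ht, ht1, rfl⟩, ?_⟩
    rw [dist_eq_norm, ← Finset.sum_sub_distrib]
    calc ‖∑ i, (t i • v i - t i • w i)‖ ≤ ∑ i, t i * dist v w := by
          refine (norm_sum_le _ _).trans (Finset.sum_le_sum fun i _ => ?_)
          rw [← smul_sub, norm_smul, Real.norm_eq_abs, abs_of_nonneg (ht i), ← dist_eq_norm]
          exact mul_le_mul_of_nonneg_left (dist_le_pi_dist v w i) (ht i)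
      _ ≤ 1 * dist v w := by
        rw [← Finset.sum_mul]
        gcongr
      _ = _ := one_mul _
  refine (LipschitzWith.of_dist_le_mul (K := 1) fun v w => ?_).continuous
  rw [NNReal.coe_one, one_mul, Subtype.dist_eq, ← ConvexBody.hausdorffDist_coe]
  refine Metric.hausdorffDist_le_of_mem_dist dist_nonneg (key v w) fun x hx => ?_
  rw [dist_comm]
  exact key w v x hx

theorem slImage_simplexBody {n : ℕ} (φ : Matrix.SpecialLinearGroup (Fin n) ℝ) (v : Fin n → Euc n) :
    slImage φ (simplexBody v) = simplexBody fun i => Matrix.toEuclideanCLM (𝕜 := ℝ) φ.1 (v i) := by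
  refine BodyO.ext_toSet (Set.ext fun x => ⟨?_, ?_⟩)
  · rintro ⟨_, ⟨t, ht, ht1, rfl⟩, rfl⟩
    exact ⟨t, ht, ht1, by simp⟩
  · rintro ⟨t, ht, ht1, rfl⟩
    exact ⟨_, ⟨t, ht, ht1, rfl⟩, by simp⟩

theorem simplexBody_comp_perm {n : ℕ} (σ : Equiv.Perm (Fin n)) (v : Fin n → Euc n) :
    simplexBody (v ∘ σ) = simplexBody v := by
  have key : ∀ (σ : Equiv.Perm (Fin n)) (v : Fin n → Euc n),
      (simplexBody (v ∘ σ)).toSet ⊆ (simplexBody v).toSet := by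
    rintro σ v _ ⟨t, ht, ht1, rfl⟩
    refine ⟨t ∘ σ.symm, fun i => ht _, ?_, ?_⟩
    · rwa [← Equiv.sum_comp σ.symm] at ht1
    · rw [← Equiv.sum_comp σ.symm]
      simp
  refine BodyO.ext_toSet (Set.Subset.antisymm (key σ v) ?_)
  have := key σ.symm (v ∘ σ)
  rwa [Function.comp_assoc, Equiv.self_comp_symm, Function.comp_id] at this

/-! ### Reduction of valuations to simplices by cutting with hyperplanes through the origin -/

/-- Linear functionals on `ℝⁿ`. -/
abbrev Fnl (n : ℕ) : Type := Module.Dual ℝ (Euc n)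

theorem continuous_fnl {n : ℕ} (r : Fnl n) : Continuous r := r.continuous_of_finiteDimensional

/-- The part of a body where all functionals in `R` are nonnegative. -/
def cutBody {n : ℕ} (K : BodyO n) (R : Set (Fnl n)) : BodyO n :=
  ⟨{ carrier := {x | x ∈ K.1 ∧ ∀ r ∈ R, 0 ≤ r x}
     convex' := by
      rintro x ⟨hx, hxR⟩ y ⟨hy, hyR⟩ a b ha hb hab
      refine ⟨K.1.convex hx hy ha hb hab, fun r hr => ?_⟩
      have h1 := hxR r hr
      have h2 := hyR r hr
      rw [map_add, map_smul, map_smul, smul_eq_mul, smul_eq_mul]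
      positivity
     isCompact' := by
      have h : IsClosed {x | ∀ r ∈ R, 0 ≤ r x} := by
        simp only [Set.ofPred_forall]
        exact isClosed_biInter fun r _ => isClosed_le continuous_const (continuous_fnl r)
      exact K.1.isCompact.inter_right h
     nonempty' := ⟨0, K.2, by simp⟩ }, ⟨K.2, by simp⟩⟩

theorem mem_cutBody {n : ℕ} {K : BodyO n} {R : Set (Fnl n)} {x : Euc n} :
    x ∈ (cutBody K R).toSet ↔ x ∈ K.toSet ∧ ∀ r ∈ R, 0 ≤ r x := Iff.rfl

theorem cutBody_empty {n : ℕ} (K : BodyO n) : cutBody K ∅ = K :=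
  BodyO.ext_toSet (Set.ext fun x => by simp [mem_cutBody])

theorem cutBody_cutBody {n : ℕ} (K : BodyO n) (R R' : Set (Fnl n)) :
    cutBody (cutBody K R) R' = cutBody K (R ∪ R') :=
  BodyO.ext_toSet (Set.ext fun x => by
    simp only [mem_cutBody, Set.mem_union]
    grind)

/-- Real-valued valuations on convex bodies containing the origin. -/
def IsVal {n : ℕ} (g : BodyO n → ℝ) : Prop :=
  ∀ K L U I : BodyO n, U.toSet = K.toSet ∪ L.toSet → I.toSet = K.toSet ∩ L.toSet →
    g U + g I = g K + g L

theorem IsVal.cut {n : ℕ} {g : BodyO n → ℝ} (hg : IsVal g) (K : BodyO n) (r : Fnl n) :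
    g K + g (cutBody K {r, -r}) = g (cutBody K {r}) + g (cutBody K {-r}) := by
  apply hg
  · ext x
    simp only [Set.mem_union, mem_cutBody, Set.mem_singleton_iff, forall_eq, LinearMap.neg_apply,
      Left.nonneg_neg_iff, ← and_or_left]
    exact ⟨fun h => ⟨h, le_total _ _⟩, fun h => h.1⟩
  · ext x
    simp only [Set.mem_inter_iff, mem_cutBody, Set.mem_singleton_iff, forall_eq,
      Set.mem_insert_iff, forall_eq_or_imp]
    tauto

/-- `g` vanishes on all finite cuts of `K` by functionals from `S`. -/
def VanishesOnCuts {n : ℕ} (g : BodyO n → ℝ) (S : Submodule ℝ (Fnl n)) (K : BodyO n) : Prop :=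
  ∀ R : Set (Fnl n), R.Finite → R ⊆ S → g (cutBody K R) = 0

namespace VanishesOnCuts

variable {n : ℕ} {g : BodyO n → ℝ} {S : Submodule ℝ (Fnl n)} {K : BodyO n}

theorem apply_self (h : VanishesOnCuts g S K) : g K = 0 := by
  simpa [cutBody_empty] using h ∅ Set.finite_empty (Set.empty_subset _)

theorem cutBody (h : VanishesOnCuts g S K) {R : Set (Fnl n)} (hR : R.Finite) (hRS : R ⊆ S) :
    VanishesOnCuts g S (cutBody K R) := fun R' hR' hRS' => by
  rw [cutBody_cutBody]
  exact h _ (hR.union hR') (Set.union_subset hRS hRS')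

/-- Cutting by R first and then along r = 0, every other term of the valuation identity is a cut of
one of the halves; the section r = 0 is the half r ≥ 0 cut by -r. Quantifying over all cuts thus
controls the intersection terms without a separate induction on dimension. -/
theorem of_two (hg : IsVal g) {r : Fnl n} (hr : r ∈ S)
    (h₁ : VanishesOnCuts g S (LpMinkowski.cutBody K {r}))
    (h₂ : VanishesOnCuts g S (LpMinkowski.cutBody K {-r})) : VanishesOnCuts g S K := by
  intro R hR hRS
  have h := hg.cut (LpMinkowski.cutBody K R) r
  have e1 := h₁ R hR hRS
  have e2 := h₂ R hR hRS
  have e3 := h₁ (insert (-r) R) (hR.insert _)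
    (Set.insert_subset (S.neg_mem hr) hRS)
  rw [cutBody_cutBody] at e1 e2 e3
  rw [cutBody_cutBody, cutBody_cutBody, cutBody_cutBody, Set.union_comm R {r},
    Set.union_comm R {-r}, e1, e2] at h
  have e4 : R ∪ {r, -r} = {r} ∪ insert (-r) R := by
    ext x
    simp only [Set.mem_union, Set.mem_insert_iff, Set.mem_singleton_iff]
    tauto
  rw [e4, e3] at h
  linarith

/-- If `g` vanishes on all cuts of the pieces of `K` on which a given functional is minimal among
finitely many, it vanishes on all cuts of `K`. -/
theorem of_cover (hg : IsVal g) {J : Finset (Fnl n)} (hJ : J.Nonempty)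
    (hS : ∀ a ∈ J, ∀ b ∈ J, a - b ∈ S) :
    ∀ K, (∀ j ∈ J, VanishesOnCuts g S (LpMinkowski.cutBody K ((· - j) '' (J : Set (Fnl n))))) →
      VanishesOnCuts g S K := by
  induction hJ using Finset.Nonempty.cons_induction with
  | singleton k =>
    intro K h
    have h1 := h k (by simp)
    have h2 : LpMinkowski.cutBody K ((· - k) '' (({k} : Finset (Fnl n)) : Set (Fnl n))) = K :=
      BodyO.ext_toSet (Set.ext fun x => by simp [mem_cutBody])
    rwa [h2] at h1
  | cons k J' hk hJ' ih =>
    intro K h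
    refine ih (fun a ha b hb => hS a (by simp [ha]) b (by simp [hb])) K fun j hj => ?_
    have hkj : k - j ∈ S := hS k (by simp) j (by simp [hj])
    -- Where k ≥ j, the functional j is least in the whole family. Where k ≤ j, the piece is the one
    -- on which k is least, cut further by the differences a - j.
    refine of_two hg hkj ?_ ?_
    · have h1 := h j (by simp [hj])
      rw [cutBody_cutBody]
      convert h1 using 2
      ext x
      simp [eq_comm (a := x)]
    · have h1 := (h k (by simp)).cutBody (R := (· - j) '' (J' : Set (Fnl n)))
        (J'.finite_toSet.image _) (by
          rintro _ ⟨a, ha, rfl⟩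
          exact hS a (by simpa using Or.inr ha) j (by simp [hj]))
      convert h1 using 1
      refine BodyO.ext_toSet (Set.ext fun x => ?_)
      simp only [cutBody_cutBody, mem_cutBody, Set.mem_union, Set.mem_image, Finset.mem_coe,
        Finset.mem_cons, Set.mem_singleton_iff, neg_sub]
      refine and_congr_right fun _ => ⟨fun h => ?_, fun h => ?_⟩
      · have hjk := h (j - k) (Or.inr rfl)
        rintro r (⟨a, rfl | ha, rfl⟩ | ⟨a, ha, rfl⟩)
        · simp
        · have := h (a - j) (Or.inl ⟨a, ha, rfl⟩)
          simp only [LinearMap.sub_apply] at *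
          linarith
        · exact h _ (Or.inl ⟨a, ha, rfl⟩)
      · rintro r (⟨a, ha, rfl⟩ | rfl)
        · exact h _ (Or.inr ⟨a, ha, rfl⟩)
        · exact h _ (Or.inl ⟨j, Or.inr hj, rfl⟩)

end VanishesOnCuts

/-! ### Triangulation of polytopes by cones with apex at the origin -/

/-- Completing the edge vectors of a degenerate simplex to a basis lets every simplex be written as
`restr s b`, with determinants available. -/
theorem exists_linearIndependent_extension {n : ℕ} (s : Finset (Fin n)) :
    ∀ v : Fin n → Euc n, LinearIndepOn ℝ v s →
      ∃ b : Fin n → Euc n, LinearIndependent ℝ b ∧ ∀ i ∈ s, b i = v i := by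
  induction hk : sᶜ.card generalizing s with
  | zero =>
    intro v hv
    have hs : s = Finset.univ := by simpa using hk
    subst hs
    exact ⟨v, by simpa [linearIndepOn_univ_iff] using hv, fun _ _ => rfl⟩
  | succ k ih =>
    intro v hv
    obtain ⟨i, hi⟩ : sᶜ.Nonempty := Finset.card_pos.1 (by omega)
    have his : i ∉ s := by simpa using hi
    have hcard : s.card < n := by
      have := Finset.card_compl s
      rw [Fintype.card_fin] at this
      omega
    obtain ⟨x, hx⟩ : ∃ x : Euc n, x ∉ Submodule.span ℝ (v '' s) := by
      by_contra! hcon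
      have h1 : Submodule.span ℝ (v '' s) = ⊤ := eq_top_iff.2 fun x _ => hcon x
      have h2 := finrank_span_finset_le_card (R := ℝ) (s.image v)
      rw [Finset.coe_image, Set.finrank, h1, finrank_top, finrank_euclideanSpace_fin] at h2
      have := Finset.card_image_le (s := s) (f := v)
      omega
    have heq : Set.EqOn (Function.update v i x) v s := fun j hj =>
      Function.update_of_ne (fun h : j = i => his (h ▸ hj)) _ _
    have hv' : LinearIndepOn ℝ (Function.update v i x) (insert i s : Finset (Fin n)) := by
      rw [Finset.coe_insert, linearIndepOn_insert (by simpa using his), heq.image_eq,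
        Function.update_self]
      exact ⟨hv.congr heq.symm, hx⟩
    obtain ⟨b, hb, hbs⟩ := ih (insert i s) (by
      rw [Finset.compl_insert, Finset.card_erase_of_mem hi]; omega) _ hv'
    exact ⟨b, hb, fun j hj => by rw [hbs j (by simp [hj]), heq hj]⟩

/-- The family `b` with the entries outside `s` replaced by zero. -/
def restr {n : ℕ} (s : Finset (Fin n)) (b : Fin n → Euc n) : Fin n → Euc n :=
  fun i => if i ∈ s then b i else 0

theorem linearIndepOn_of_dual {n : ℕ} {s : Finset (Fin n)} {w : Fin n → Euc n} {m : Fin n → Fnl n}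
    (h1 : ∀ i ∈ s, m i (w i) = 1) (h2 : ∀ i ∈ s, ∀ j ∈ s, j ≠ i → m i (w j) = 0) :
    LinearIndepOn ℝ w s := by
  rw [linearIndepOn_finset_iff]
  intro f hf i hi
  have := congrArg (m i) hf
  rw [map_sum, map_zero, Finset.sum_eq_single_of_mem i hi fun j hj hji => by
    rw [map_smul, h2 i hi j hj hji, smul_zero]] at this
  simpa [h1 i hi] using this

/-- Vanishing of a valuation on truncated polyhedral cones `{mᵢ ≥ 0, q ≥ 0, ℓ ≤ 1}`. -/
theorem apply_truncatedCone_eq_zero {n : ℕ} {g : BodyO n → ℝ} (hg : IsVal g)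
    (hsimp : ∀ b : Fin n → Euc n, LinearIndependent ℝ b → ∀ s, g (simplexBody (restr s b)) = 0)
    (s : Finset (Fin n)) :
    ∀ (w : Fin n → Euc n) (m : Fin n → Fnl n) (Q : Set (Fnl n)) (ℓ : Fnl n) (K : BodyO n),
    Q.Finite → (∀ i ∈ s, m i (w i) = 1) → (∀ i ∈ s, ∀ j ∈ s, j ≠ i → m i (w j) = 0) →
    (∀ q ∈ Q, ∀ i ∈ s, q (w i) = 0) →
    (∀ x, (∀ i ∈ s, 0 ≤ m i x) → (∀ q ∈ Q, 0 ≤ q x) → x ≠ 0 → 0 < ℓ x) →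
    (K.toSet = {x | (∀ i ∈ s, 0 ≤ m i x) ∧ (∀ q ∈ Q, 0 ≤ q x) ∧ ℓ x ≤ 1}) → g K = 0 := by
  induction hk : sᶜ.card using Nat.strong_induction_on generalizing s with
  | _ k ih =>
  intro w m Q ℓ K hQ hm1 hm2 hqw hpos hK
  -- The cone is the sum of the orthant spanned by the w i with i ∈ s and of E = {m i = 0, q ≥ 0}.
  -- If E = 0 the cone is simplicial, and ℓ ≤ 1 truncates its edges at w i / ℓ (w i).
  by_cases hE : ∀ x, (∀ i ∈ s, m i x = 0) → (∀ q ∈ Q, 0 ≤ q x) → x = 0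
  · have hmw : ∀ i ∈ s, ∀ j ∈ s, m j (w i) = if i = j then 1 else 0 := by
      intro i hi j hj
      split_ifs with h
      · rw [h, hm1 j hj]
      · exact hm2 j hj i hi h
    have hℓ : ∀ i ∈ s, 0 < ℓ (w i) := by
      intro i hi
      refine hpos _ (fun j hj => ?_) (fun q hq => (hqw q hq i hi).ge) fun h => ?_
      · rw [hmw i hi j hj]
        split_ifs <;> simp
      · have := hm1 i hi
        rw [h, map_zero] at this
        exact zero_ne_one this
    set v : Fin n → Euc n := fun i => (ℓ (w i))⁻¹ • w i with hv
    obtain ⟨b, hb, hbs⟩ := exists_linearIndependent_extension s v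
      (linearIndepOn_of_dual (m := fun i => ℓ (w i) • m i)
        (fun i hi => by simp [hv, hm1 i hi, (hℓ i hi).ne'])
        fun i hi j hj hji => by simp [hv, hm2 i hi j hj hji])
    have hKs : K = simplexBody (restr s b) := by
      refine BodyO.ext_toSet (hK.trans (Set.ext fun x => ⟨?_, ?_⟩))
      · rintro ⟨hx1, hx2, hx3⟩
        have hx : x = ∑ i ∈ s, m i x • w i := by
          refine sub_eq_zero.1 (hE _ (fun j hj => ?_) fun q hq => ?_)
          · rw [map_sub, map_sum, Finset.sum_eq_single_of_mem j hj fun i hi hij => by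
              rw [map_smul, hm2 j hj i hi hij, smul_zero], map_smul, hm1 j hj]
            simp
          · rw [map_sub, map_sum, Finset.sum_eq_zero fun i hi => by
              rw [map_smul, hqw q hq i hi, smul_zero], sub_zero]
            exact hx2 q hq
        refine ⟨fun i => if i ∈ s then m i x * ℓ (w i) else 0, fun i => ?_, ?_, ?_⟩
        · dsimp only
          split_ifs with hi
          · exact mul_nonneg (hx1 i hi) (hℓ i hi).le
          · exact le_rfl
        · rw [Finset.sum_ite_mem, Finset.univ_inter]
          calc _ = ℓ (∑ i ∈ s, m i x • w i) := by simp
            _ ≤ 1 := by rwa [← hx]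
        · conv_lhs => rw [hx]
          simp only [ite_smul, zero_smul, Finset.sum_ite_mem, Finset.univ_inter]
          refine Finset.sum_congr rfl fun i hi => ?_
          rw [restr, if_pos hi, hbs i hi, hv, smul_smul, mul_assoc,
            mul_inv_cancel₀ (hℓ i hi).ne', mul_one]
      · rintro ⟨t, ht, ht1, rfl⟩
        have hx : ∑ i, t i • restr s b i = ∑ i ∈ s, (t i * (ℓ (w i))⁻¹) • w i := by
          simp only [restr, smul_ite, smul_zero, Finset.sum_ite_mem, Finset.univ_inter]
          refine Finset.sum_congr rfl fun i hi => ?_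
          rw [hbs i hi, hv, smul_smul]
        rw [hx]
        refine ⟨fun j hj => ?_, fun q hq => ?_, ?_⟩
        · rw [map_sum, Finset.sum_eq_single_of_mem j hj fun i hi hij => by
              rw [map_smul, hm2 j hj i hi hij, smul_zero], map_smul, hm1 j hj]
          have := ht j
          have := hℓ j hj
          simp only [smul_eq_mul]
          positivity
        · rw [map_sum, Finset.sum_eq_zero fun i hi => by
              rw [map_smul, hqw q hq i hi, smul_zero]]
        · rw [map_sum]
          calc _ = ∑ i ∈ s, t i := Finset.sum_congr rfl fun i hi => by
                rw [map_smul, smul_eq_mul, mul_assoc, inv_mul_cancel₀ (hℓ i hi).ne', mul_one]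
            _ ≤ ∑ i, t i := Finset.sum_le_sum_of_subset_of_nonneg (Finset.subset_univ s)
                fun i _ _ => ht i
            _ ≤ 1 := ht1
    rw [hKs]
    exact hsimp b hb s
  · push Not at hE
    obtain ⟨y, hym, hyq, hy0⟩ := hE
    -- A nonzero y ∈ E becomes the next edge. An index is free for it, since otherwise w would be a
    -- basis whose dual functionals all vanish at y.
    obtain ⟨a, ha⟩ : sᶜ.Nonempty := by
      rw [Finset.nonempty_iff_ne_empty]
      intro h
      have hs : s = Finset.univ := by simpa using h
      subst hs
      have hli : LinearIndependent ℝ w := by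
        have := linearIndepOn_of_dual (s := Finset.univ) hm1 hm2
        simpa [linearIndepOn_univ_iff] using this
      have hspan := hli.span_eq_top_of_card_eq_finrank' (by simp)
      have hmem : y ∈ Submodule.span ℝ (Set.range w) := hspan ▸ Submodule.mem_top
      obtain ⟨c, rfl⟩ := (Submodule.mem_span_range_iff_exists_fun ℝ).1 hmem
      refine hy0 (Finset.sum_eq_zero fun i _ => ?_)
      have := hym i (Finset.mem_univ i)
      rw [map_sum, Finset.sum_eq_single i (fun j hj hji => by
        rw [map_smul, hm2 i (Finset.mem_univ i) j hj hji, smul_zero]) (by simp),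
        map_smul, hm1 i (Finset.mem_univ i), smul_eq_mul, mul_one] at this
      rw [this, zero_smul]
    have has : a ∉ s := by simpa using ha
    have hne : ∀ i ∈ s, i ≠ a := fun i hi h => has (h ▸ hi)
    -- Otherwise y and -y both lie in the cone, although ℓ is positive at its nonzero points.
    obtain ⟨q₀, hq₀, hq₀y⟩ : ∃ q ∈ Q, 0 < q y := by
      by_contra! hcon
      have h1 := hpos y (fun i hi => (hym i hi).ge) hyq hy0
      have h2 := hpos (-y) (fun i hi => by simp [hym i hi])
        (fun q hq => by simpa using hcon q hq) (neg_ne_zero.2 hy0)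
      rw [map_neg] at h2
      linarith
    classical
    -- The constraints positive at y, normalised to 1 there. Where j is the least of them, x - j(x)
    -- y still satisfies every constraint in Q, so that piece splits off the ray through y, with
    -- dual functional j; the differences a - j vanish at y and become new constraints.
    set J : Finset (Fnl n) :=
      (hQ.toFinset.filter fun q => 0 < q y).image fun q => (q y)⁻¹ • q with hJdef
    have hJmem : ∀ {j}, j ∈ J ↔ ∃ q ∈ Q, 0 < q y ∧ (q y)⁻¹ • q = j := by
      intro j
      simp [hJdef, and_assoc]
    have hJy : ∀ j ∈ J, j y = 1 := by
      intro j hj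
      obtain ⟨q, hq, hqy, rfl⟩ := hJmem.1 hj
      simp [hqy.ne']
    have hJw : ∀ j ∈ J, ∀ i ∈ s, j (w i) = 0 := by
      intro j hj i hi
      obtain ⟨q, hq, hqy, rfl⟩ := hJmem.1 hj
      simp [hqw q hq i hi]
    -- Cuts by functionals vanishing at y and at all w i are again admissible constraints, so the
    -- induction hypothesis also covers every further cut.
    let S : Submodule ℝ (Fnl n) :=
      { carrier := {r | r y = 0 ∧ ∀ i ∈ s, r (w i) = 0}
        add_mem' := by
          rintro r r' ⟨h1, h2⟩ ⟨h3, h4⟩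
          exact ⟨by simp [h1, h3], fun i hi => by simp [h2 i hi, h4 i hi]⟩
        zero_mem' := by simp
        smul_mem' := by
          rintro c r ⟨h1, h2⟩
          exact ⟨by simp [h1], fun i hi => by simp [h2 i hi]⟩ }
    have hdiff : ∀ b ∈ J, ∀ c ∈ J, b - c ∈ S := fun b hb c hc =>
      ⟨by simp [hJy b hb, hJy c hc], fun i hi => by simp [hJw b hb i hi, hJw c hc i hi]⟩
    have hgood : VanishesOnCuts g S K := by
      refine VanishesOnCuts.of_cover hg ⟨_, hJmem.2 ⟨q₀, hq₀, hq₀y, rfl⟩⟩ hdiff K ?_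
      intro j hj R hR hRS
      rw [cutBody_cutBody]
      set Q' : Set (Fnl n) := ((· - j) '' (J : Set (Fnl n)) ∪ R) ∪ {q ∈ Q | q y = 0} with hQ'
      have hQ's : ∀ q ∈ Q', q y = 0 ∧ ∀ i ∈ s, q (w i) = 0 := by
        rintro q ((⟨b, hb, rfl⟩ | hq) | ⟨hq, hqy⟩)
        · exact hdiff b hb j hj
        · exact hRS hq
        · exact ⟨hqy, hqw q hq⟩
      have hcone : ∀ x, ((∀ i ∈ s, 0 ≤ m i x) ∧ (∀ q ∈ Q, 0 ≤ q x) ∧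
          ∀ r ∈ (· - j) '' (J : Set (Fnl n)) ∪ R, 0 ≤ r x) ↔
          ((∀ i ∈ insert a s, 0 ≤ Function.update m a j i x) ∧ ∀ q ∈ Q', 0 ≤ q x) := by
        intro x
        have hupd : (∀ i ∈ insert a s, 0 ≤ Function.update m a j i x) ↔
            0 ≤ j x ∧ ∀ i ∈ s, 0 ≤ m i x := by
          rw [Finset.forall_mem_insert, Function.update_self]
          refine and_congr_right fun _ => forall₂_congr fun i hi => ?_
          rw [Function.update_of_ne (hne i hi)]
        rw [hupd]
        constructor
        · rintro ⟨h1, h2, h3⟩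
          refine ⟨⟨?_, h1⟩, ?_⟩
          · obtain ⟨q, hq, hqy, rfl⟩ := hJmem.1 hj
            have := h2 q hq
            simp only [LinearMap.smul_apply, smul_eq_mul]
            positivity
          · rintro q (hq | ⟨hq, -⟩)
            · exact h3 q hq
            · exact h2 q hq
        · rintro ⟨⟨h1, h2⟩, h3⟩
          refine ⟨h2, fun q hq => ?_, fun r hr => h3 r (Or.inl hr)⟩
          rcases (hyq q hq).eq_or_lt with h | h
          · exact h3 q (Or.inr ⟨hq, h.symm⟩)
          · have h4 := h3 ((q y)⁻¹ • q - j) (Or.inl (Or.inl ⟨_, hJmem.2 ⟨q, hq, h, rfl⟩, rfl⟩))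
            simp only [LinearMap.sub_apply, LinearMap.smul_apply, smul_eq_mul] at h4
            have h5 : 0 ≤ (q y)⁻¹ * q x := by linarith
            exact nonneg_of_mul_nonneg_right h5 (by positivity)
      refine ih (insert a s)ᶜ.card ?_ (insert a s) rfl (Function.update w a y)
        (Function.update m a j) Q' ℓ _ ?_ ?_ ?_ ?_ ?_ ?_
      · rw [← hk, Finset.compl_insert]
        exact Finset.card_erase_lt_of_mem ha
      · exact ((J.finite_toSet.image _).union hR).union (hQ.subset (Set.sep_subset _ _))
      · intro i hi
        rcases Finset.mem_insert.1 hi with rfl | hi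
        · simp [hJy j hj]
        · rw [Function.update_of_ne (hne i hi), Function.update_of_ne (hne i hi), hm1 i hi]
      · intro i hi l hl hli
        rcases Finset.mem_insert.1 hi with rfl | hi'
        · rcases Finset.mem_insert.1 hl with rfl | hl'
          · exact absurd rfl hli
          · rw [Function.update_self, Function.update_of_ne hli, hJw j hj l hl']
        · rw [Function.update_of_ne (hne i hi')]
          rcases Finset.mem_insert.1 hl with rfl | hl'
          · rw [Function.update_self, hym i hi']
          · rw [Function.update_of_ne (hne l hl'), hm2 i hi' l hl' hli]
      · intro q hq i hi
        rcases Finset.mem_insert.1 hi with rfl | hi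
        · rw [Function.update_self, (hQ's q hq).1]
        · rw [Function.update_of_ne (hne i hi), (hQ's q hq).2 i hi]
      · intro x h1 h2
        obtain ⟨h3, h4, -⟩ := (hcone x).2 ⟨h1, h2⟩
        exact hpos x h3 h4
      · ext x
        have := hcone x
        rw [mem_cutBody, hK]
        simp only [Set.mem_ofPred_eq]
        tauto
    exact hgood.apply_self

/-- Vanishing of a valuation on polytopes `{x | ℓ x ≤ 1 for ℓ ∈ A}`. -/
theorem apply_polytope_eq_zero {n : ℕ} {g : BodyO n → ℝ} (hg : IsVal g)
    (hsimp : ∀ b : Fin n → Euc n, LinearIndependent ℝ b → ∀ s, g (simplexBody (restr s b)) = 0)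
    (A : Finset (Fnl n)) (P : BodyO n) (hP : P.toSet = {x | ∀ ℓ ∈ A, ℓ x ≤ 1}) : g P = 0 := by
  classical
  -- The least -ℓ is the largest ℓ: on each piece a single inequality ℓ x ≤ 1 implies all the
  -- others. Adding 0 leaves the polytope unchanged and makes the family nonempty.
  set J : Finset (Fnl n) := (insert 0 A).image fun ℓ => -ℓ with hJ
  have hJ0 : (0 : Fnl n) ∈ J := by simp [hJ]
  have hJmem : ∀ {j}, j ∈ J ↔ ∃ ℓ ∈ insert 0 A, -ℓ = j := by
    intro j
    simp [hJ, eq_comm (a := j)]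
  have hP' : P.toSet = {x | ∀ ℓ ∈ insert 0 A, ℓ x ≤ 1} := by
    rw [hP]
    ext x
    simp
  refine VanishesOnCuts.apply_self (S := ⊤) (VanishesOnCuts.of_cover hg ⟨0, hJ0⟩
    (fun _ _ _ _ => Submodule.mem_top) P fun j hj R hR _ => ?_)
  obtain ⟨ℓ, hℓ, rfl⟩ := hJmem.1 hj
  rw [cutBody_cutBody]
  have hset : ∀ x, x ∈ (cutBody P ((· - -ℓ) '' (J : Set (Fnl n)) ∪ R)).toSet ↔
      (∀ q ∈ (· - -ℓ) '' (J : Set (Fnl n)) ∪ R, 0 ≤ q x) ∧ ℓ x ≤ 1 := by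
    intro x
    rw [mem_cutBody, hP', and_comm]
    refine and_congr_right fun h => ⟨fun h1 => h1 ℓ hℓ, fun h1 ℓ' hℓ' => ?_⟩
    have := h (-ℓ' - -ℓ) (Or.inl ⟨-ℓ', hJmem.2 ⟨ℓ', hℓ', rfl⟩, rfl⟩)
    simp only [LinearMap.sub_apply, LinearMap.neg_apply] at this
    linarith
  refine apply_truncatedCone_eq_zero hg hsimp ∅ 0 0 ((· - -ℓ) '' (J : Set (Fnl n)) ∪ R) ℓ _
    ((J.finite_toSet.image _).union hR) (by simp) (by simp) (by simp) ?_ ?_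
  · intro x _ hx hx0
    -- If ℓ x ≤ 0, the whole ray through x stays in the piece, contradicting compactness.
    by_contra! hcon
    obtain ⟨B, hB⟩ := P.1.isCompact.isBounded.exists_norm_le
    have h1 : ∀ t : ℝ, 0 ≤ t → t * ‖x‖ ≤ B := by
      intro t ht
      have h2 : t • x ∈ (cutBody P ((· - -ℓ) '' (J : Set (Fnl n)) ∪ R)).toSet := by
        rw [hset]
        refine ⟨fun q hq => ?_, ?_⟩
        · rw [map_smul, smul_eq_mul]
          exact mul_nonneg ht (hx q hq)
        · rw [map_smul, smul_eq_mul]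
          nlinarith
      have h3 := hB _ (mem_cutBody.1 h2).1
      rwa [norm_smul, Real.norm_eq_abs, abs_of_nonneg ht] at h3
    have hxn : 0 < ‖x‖ := norm_pos_iff.2 hx0
    have hB0 : 0 ≤ B := by simpa using h1 0 le_rfl
    have := h1 ((B + 1) / ‖x‖) (by positivity)
    rw [div_mul_cancel₀ _ hxn.ne'] at this
    linarith
  · ext x
    rw [hset]
    simp

/-- Every body is approximated by polytopes `{x | ℓ x ≤ 1 for ℓ ∈ A}`. -/
theorem exists_polytope_dist_le {n : ℕ} (K : BodyO n) {δ : ℝ} (hδ : 0 < δ) :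
    ∃ (A : Finset (Fnl n)) (P : BodyO n), P.toSet = {x | ∀ ℓ ∈ A, ℓ x ≤ 1} ∧ dist P K ≤ δ := by
  have hKne : K.toSet.Nonempty := K.1.nonempty
  set T : Set (Euc n) := {x | Metric.infDist x K.toSet = δ} with hT
  have hcl : IsClosed T := isClosed_eq (Metric.continuous_infDist_pt _) continuous_const
  have hbdd : Bornology.IsBounded (Metric.cthickening δ K.toSet) :=
    K.1.isCompact.isBounded.cthickening
  have hthick : ∀ x, Metric.infDist x K.toSet ≤ δ → x ∈ Metric.cthickening δ K.toSet := by
    intro x hx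
    obtain ⟨y, hy, hxy⟩ := K.1.isCompact.exists_infDist_eq_dist hKne x
    exact Metric.mem_cthickening_of_dist_le x y δ _ hy (hxy ▸ hx)
  have hTc : IsCompact T := Metric.isCompact_of_isClosed_isBounded hcl
    (hbdd.subset fun x hx => hthick x (le_of_eq hx))
  have hsep : ∀ x ∈ T, ∃ ℓ : Fnl n, (∀ y ∈ K.toSet, ℓ y ≤ 1) ∧ 1 < ℓ x := by
    intro x hx
    have hxK : x ∉ K.1 := fun h => by
      have : Metric.infDist x K.toSet = 0 := Metric.infDist_zero_of_mem h
      rw [hT, Set.mem_ofPred_eq, this] at hx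
      exact hδ.ne hx
    obtain ⟨u, -, y, hy, hxy⟩ := exists_separating_direction K.1 hxK
    have hd : 0 < dist x y := dist_pos.2 fun h => hxK (h ▸ hy)
    have h0 := supportFun_nonneg K u
    -- A level halfway between K and x. It is positive because 0 ∈ K, so the half-space can be
    -- normalised to ℓ ≤ 1.
    set c := supportFun K.1 u + dist x y / 2 with hc
    have hc0 : 0 < c := by positivity
    have happ : ∀ z, (c⁻¹ • (innerSL ℝ u).toLinearMap : Fnl n) z = c⁻¹ * inner ℝ z u := by
      intro z
      simp [real_inner_comm]
    refine ⟨c⁻¹ • (innerSL ℝ u).toLinearMap, fun z hz => ?_, ?_⟩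
    · rw [happ, inv_mul_le_iff₀ hc0, mul_one]
      have := inner_le_supportFun K.1 hz u
      linarith
    · rw [happ, lt_inv_mul_iff₀ hc0, mul_one]
      linarith
  choose! f hf1 hf2 using hsep
  obtain ⟨t, htT, htf, hcov⟩ := hTc.elim_finite_subcover_image (b := T)
    (c := fun x => {y | 1 < f x y})
    (fun x _ => isOpen_lt continuous_const (continuous_fnl _))
    (fun x hx => Set.mem_iUnion₂.2 ⟨x, hx, hf2 x hx⟩)
  classical
  set A : Finset (Fnl n) := htf.toFinset.image f with hA
  have hAmem : ∀ x, (∀ ℓ ∈ A, ℓ x ≤ 1) ↔ ∀ y ∈ t, f y x ≤ 1 := by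
    intro x
    simp [hA]
  have hKP : K.toSet ⊆ {x | ∀ ℓ ∈ A, ℓ x ≤ 1} := fun x hx =>
    (hAmem x).2 fun y hy => hf1 y (htT hy) x hx
  have hconv : Convex ℝ {x : Euc n | ∀ ℓ ∈ A, ℓ x ≤ 1} := by
    intro x hx y hy a b ha hb hab ℓ hℓ
    have h1 := hx ℓ hℓ
    have h2 := hy ℓ hℓ
    rw [map_add, map_smul, map_smul, smul_eq_mul, smul_eq_mul]
    nlinarith
  have hlt : ∀ x ∈ {x : Euc n | ∀ ℓ ∈ A, ℓ x ≤ 1}, Metric.infDist x K.toSet < δ := by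
    intro x hx
    by_contra! hcon
    -- The polytope is connected and contains 0 ∈ K, so a point at distance at least δ would yield
    -- one at distance exactly δ; the finitely many half-spaces exclude all such points.
    obtain ⟨z, hz, hzδ⟩ := hconv.isPreconnected.intermediate_value (hKP K.2) hx
      (Metric.continuous_infDist_pt K.toSet).continuousOn
      ⟨by rw [Metric.infDist_zero_of_mem (show (0 : Euc n) ∈ K.toSet from K.2)]; exact hδ.le, hcon⟩
    obtain ⟨y, hy, hyz⟩ := Set.mem_iUnion₂.1 (hcov hzδ)
    exact absurd ((hAmem z).1 hz y hy) (not_le.2 hyz)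
  have hPcl : IsClosed {x : Euc n | ∀ ℓ ∈ A, ℓ x ≤ 1} := by
    simp only [Set.ofPred_forall]
    exact isClosed_biInter fun ℓ _ => isClosed_le (continuous_fnl ℓ) continuous_const
  refine ⟨A, ⟨⟨{x | ∀ ℓ ∈ A, ℓ x ≤ 1}, hconv, Metric.isCompact_of_isClosed_isBounded hPcl
    (hbdd.subset fun x hx => hthick x (hlt x hx).le), ⟨0, hKP K.2⟩⟩, hKP K.2⟩, rfl, ?_⟩
  rw [Subtype.dist_eq, ← ConvexBody.hausdorffDist_coe]
  refine Metric.hausdorffDist_le_of_mem_dist hδ.le (fun x hx => ?_) fun x hx =>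
    ⟨x, hKP hx, by simpa using hδ.le⟩
  obtain ⟨y, hy, hxy⟩ := K.1.isCompact.exists_infDist_eq_dist hKne x
  exact ⟨y, hy, hxy ▸ (hlt x hx).le⟩

/-- A continuous valuation vanishing on simplices with a vertex at the origin is zero. -/
theorem IsVal.eq_zero_of_simplexBody {n : ℕ} {g : BodyO n → ℝ} (hg : IsVal g) (hc : Continuous g)
    (hsimp : ∀ b : Fin n → Euc n, LinearIndependent ℝ b → ∀ s, g (simplexBody (restr s b)) = 0)
    (K : BodyO n) : g K = 0 := by
  have hcl : IsClosed {K | g K = 0} := isClosed_eq hc continuous_const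
  rw [← Set.mem_ofPred_eq (p := fun K => g K = 0), ← hcl.closure_eq, Metric.mem_closure_iff]
  intro ε hε
  obtain ⟨A, P, hP, hd⟩ := exists_polytope_dist_le K (half_pos hε)
  refine ⟨P, apply_polytope_eq_zero hg hsimp A P hP, ?_⟩
  rw [dist_comm]
  linarith

/-! ### Cutting a simplex through an edge -/

theorem sum_smul_update {n : ℕ} (t : Fin n → ℝ) (v : Fin n → Euc n) (j : Fin n) (w : Euc n) :
    ∑ k, t k • Function.update v j w k = ∑ k, t k • v k + t j • (w - v j) := by
  rw [← sub_eq_iff_eq_add', ← Finset.sum_sub_distrib,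
    Finset.sum_eq_single j (fun k _ hk => by rw [Function.update_of_ne hk, sub_self]) (by simp),
    Function.update_self, smul_sub]

/-- The coefficients `t` with `a` added at position `i` and `b` added at position `j`. -/
def shiftTwo {n : ℕ} (t : Fin n → ℝ) (i j : Fin n) (a b : ℝ) : Fin n → ℝ :=
  t + Pi.single i a + Pi.single j b

theorem sum_add_single_smul {n : ℕ} (t : Fin n → ℝ) (v : Fin n → Euc n) (i j : Fin n) (a b : ℝ) :
    ∑ k, shiftTwo t i j a b k • v k = ∑ k, t k • v k + a • v i + b • v j := by
  simp [shiftTwo, add_smul, Finset.sum_add_distrib, Pi.single_apply, ite_smul]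

theorem sum_add_single {n : ℕ} (t : Fin n → ℝ) (i j : Fin n) (a b : ℝ) :
    ∑ k, shiftTwo t i j a b k = ∑ k, t k + a + b := by
  simp [shiftTwo, Finset.sum_add_distrib]

theorem add_single_nonneg {n : ℕ} {t : Fin n → ℝ} {i j : Fin n} (hij : i ≠ j) {a b : ℝ}
    (ht : ∀ k, 0 ≤ t k) (hi : 0 ≤ t i + a) (hj : 0 ≤ t j + b) (k : Fin n) :
    0 ≤ shiftTwo t i j a b k := by
  by_cases h1 : k = i
  · subst h1; simpa [shiftTwo, hij] using hi
  · by_cases h2 : k = j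
    · subst h2; simpa [shiftTwo, h1] using hj
    · simpa [shiftTwo, h1, h2] using ht k

section cut

variable {n : ℕ} {v : Fin n → Euc n} {i j : Fin n} {a b : ℝ} {w : Euc n}

/-- Substitute v j = (w - a v i) / b. The coefficient sum is unchanged since a + b = 1, and the new
coefficient of v i is nonnegative exactly by the hypothesis `h`. -/
theorem mem_simplexBody_update_of_le (hij : i ≠ j) (hb : 0 < b) (hab : a + b = 1)
    (hw : w = a • v i + b • v j) {t : Fin n → ℝ} (ht : ∀ k, 0 ≤ t k) (ht1 : ∑ k, t k ≤ 1)
    (h : t j * a ≤ t i * b) : ∑ k, t k • v k ∈ (simplexBody (Function.update v j w)).toSet := by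
  have hc : t j = b * (t j / b) := by field_simp
  set c := t j / b
  have hc0 : 0 ≤ c := by
    have := ht j
    rw [hc] at this
    exact nonneg_of_mul_nonneg_right this hb
  refine ⟨shiftTwo t i j (-(a * c)) (c - t j),
    add_single_nonneg hij ht ?_ (by linarith), ?_, ?_⟩
  · rw [hc] at h
    have : b * (c * a) ≤ b * t i := by linarith
    have := le_of_mul_le_mul_left this hb
    linarith
  · rw [sum_add_single, hc]
    have : -(a * c) + (c - b * c) = 0 := by
      have : a = 1 - b := by linarith
      rw [this]; ring
    linarith
  · rw [sum_smul_update, sum_add_single_smul]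
    have : (shiftTwo t i j (-(a * c)) (c - t j)) j = c := by simp [shiftTwo, hij.symm]
    rw [this, hw, hc]
    module

theorem simplexBody_update_subset (hij : i ≠ j) (ha : 0 ≤ a) (hb : 0 ≤ b) (hab : a + b = 1)
    (hw : w = a • v i + b • v j) :
    (simplexBody (Function.update v j w)).toSet ⊆ (simplexBody v).toSet := by
  rintro _ ⟨t, ht, ht1, rfl⟩
  have h1 := ht i
  have h2 := ht j
  refine ⟨shiftTwo t i j (a * t j) (b * t j - t j),
    add_single_nonneg hij ht (by positivity) (by
      have := mul_nonneg hb h2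
      linarith), ?_, ?_⟩
  · rw [sum_add_single]
    have : a * t j + (b * t j - t j) = 0 := by
      have : a = 1 - b := by linarith
      rw [this]; ring
    linarith
  · rw [sum_smul_update, sum_add_single_smul, hw]
    module

theorem simplexBody_union (hij : i ≠ j) (ha : 0 < a) (hb : 0 < b) (hab : a + b = 1)
    (hw : w = a • v i + b • v j) :
    (simplexBody v).toSet = (simplexBody (Function.update v j w)).toSet ∪
      (simplexBody (Function.update v i w)).toSet := by
  have hba : b + a = 1 := by rw [add_comm, hab]
  have hw' : w = b • v j + a • v i := by rw [add_comm, hw]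
  apply Set.Subset.antisymm
  · rintro _ ⟨t, ht, ht1, rfl⟩
    rcases le_total (t j * a) (t i * b) with h | h
    · exact Or.inl (mem_simplexBody_update_of_le hij hb hab hw ht ht1 h)
    · exact Or.inr (mem_simplexBody_update_of_le hij.symm ha hba hw' ht ht1 h)
  · exact Set.union_subset (simplexBody_update_subset hij ha.le hb.le hab hw)
      (simplexBody_update_subset hij.symm hb.le ha.le hba hw')

theorem simplexBody_inter_subset (hij : i ≠ j) {t : Fin n → ℝ} (ht : ∀ k, 0 ≤ t k)
    (ht1 : ∑ k, t k ≤ 1) (hti : t i = 0) :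
    ∑ k, t k • Function.update v j w k ∈
      (simplexBody (Function.update (Function.update v i w) j 0)).toSet := by
  refine ⟨shiftTwo t i j (t j) (-t j),
    add_single_nonneg hij ht (by have := ht i; have := ht j; linarith) (by linarith), ?_, ?_⟩
  · rw [sum_add_single]
    linarith
  · rw [sum_smul_update, sum_smul_update, sum_smul_update, sum_add_single_smul]
    simp [shiftTwo, hij, hij.symm, hti]
    module

theorem simplexBody_inter (hij : i ≠ j) (ha : 0 < a) (hb : 0 < b)
    (hw : w = a • v i + b • v j) {α β : Fnl n} (hαi : α (v i) = 1) (hα : ∀ k, k ≠ i → α (v k) = 0)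
    (hβj : β (v j) = 1) (hβ : ∀ k, k ≠ j → β (v k) = 0) :
    (simplexBody (Function.update (Function.update v i w) j 0)).toSet =
      (simplexBody (Function.update v j w)).toSet ∩
      (simplexBody (Function.update v i w)).toSet := by
  have hsumα : ∀ t : Fin n → ℝ, α (∑ k, t k • v k) = t i := fun t => by
    rw [map_sum, Finset.sum_eq_single i (fun k _ hk => by rw [map_smul, hα k hk, smul_zero])
      (by simp), map_smul, hαi, smul_eq_mul, mul_one]
  have hsumβ : ∀ t : Fin n → ℝ, β (∑ k, t k • v k) = t j := fun t => by
    rw [map_sum, Finset.sum_eq_single j (fun k _ hk => by rw [map_smul, hβ k hk, smul_zero])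
      (by simp), map_smul, hβj, smul_eq_mul, mul_one]
  apply Set.Subset.antisymm
  · rintro _ ⟨t, ht, ht1, rfl⟩
    have h1 := ht i
    have h2 := ht j
    refine ⟨⟨shiftTwo t i j (-t i) (t i - t j),
      add_single_nonneg hij ht (by linarith) (by linarith), ?_, ?_⟩,
      ⟨shiftTwo t i j 0 (-t j),
      add_single_nonneg hij ht (by linarith) (by linarith), ?_, ?_⟩⟩
    · rw [sum_add_single]; linarith
    · rw [sum_smul_update, sum_smul_update, sum_smul_update, sum_add_single_smul]
      simp [shiftTwo, hij.symm]
      module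
    · rw [sum_add_single]; linarith
    · rw [sum_smul_update, sum_smul_update, sum_smul_update, sum_add_single_smul]
      simp [shiftTwo, hij, hij.symm]
      module
  · rintro x ⟨⟨t, ht, ht1, rfl⟩, ⟨s, hs, hs1, hx⟩⟩
    refine simplexBody_inter_subset hij ht ht1 ?_
    rw [sum_smul_update, sum_smul_update] at hx
    have h1 := congrArg α hx
    have h2 := congrArg β hx
    rw [map_add, map_add, hsumα, hsumα, hw] at h1
    rw [map_add, map_add, hsumβ, hsumβ, hw] at h2
    simp only [map_smul, map_sub, map_add, hαi, hβj, hα j hij.symm, hβ i hij, smul_eq_mul] at h1 h2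
    -- Comparing the coordinates i and j of the two representations; nonnegativity of t i and s j
    -- forces s i = t j, hence t i = 0.
    have e1 : t i = a * (s i - t j) := by linarith
    have e2 : s j = b * (t j - s i) := by linarith
    have p1 : 0 ≤ s i - t j := nonneg_of_mul_nonneg_right (e1 ▸ ht i) ha
    have p2 : 0 ≤ t j - s i := nonneg_of_mul_nonneg_right (e2 ▸ hs j) hb
    rw [e1, show s i - t j = 0 by linarith, mul_zero]

end cut

/-! ### Bases and determinants -/

/-- The `i`-th vector of the standard basis. -/
abbrev stdVec {n : ℕ} (i : Fin n) : Euc n := EuclideanSpace.basisFun (Fin n) ℝ i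

/-- The determinant of a family of `n` vectors. -/
def vecDet {n : ℕ} (b : Fin n → Euc n) : ℝ := (EuclideanSpace.basisFun (Fin n) ℝ).toBasis.det b

theorem vecDet_ne_zero_iff {n : ℕ} {b : Fin n → Euc n} :
    vecDet b ≠ 0 ↔ LinearIndependent ℝ b := by
  constructor
  · intro h
    exact ((Module.Basis.is_basis_iff_det _).2 (isUnit_iff_ne_zero.2 h)).1
  · intro h
    exact isUnit_iff_ne_zero.1 ((Module.Basis.is_basis_iff_det _).1
      ⟨h, h.span_eq_top_of_card_eq_finrank' (by simp)⟩)

theorem vecDet_stdVec {n : ℕ} : vecDet (stdVec (n := n)) = 1 := by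
  have := Module.Basis.det_self (EuclideanSpace.basisFun (Fin n) ℝ).toBasis
  rwa [OrthonormalBasis.coe_toBasis] at this

theorem vecDet_update_smul {n : ℕ} (b : Fin n → Euc n) (i : Fin n) (c : ℝ) :
    vecDet (Function.update b i (c • b i)) = c * vecDet b := by
  rw [vecDet, AlternatingMap.map_update_smul, Function.update_eq_self]
  rfl

theorem vecDet_update {n : ℕ} (b : Fin n → Euc n) {i j : Fin n} (hij : i ≠ j) (c d : ℝ) :
    vecDet (Function.update b i (c • b i + d • b j)) = c * vecDet b := by
  rw [vecDet, AlternatingMap.map_update_add, AlternatingMap.map_update_smul,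
    AlternatingMap.map_update_smul, AlternatingMap.map_update_self _ _ hij,
    Function.update_eq_self, smul_zero, add_zero]
  rfl

theorem vecDet_comp_swap {n : ℕ} (b : Fin n → Euc n) {i j : Fin n} (hij : i ≠ j) :
    vecDet (b ∘ Equiv.swap i j) = -vecDet b :=
  AlternatingMap.map_swap _ _ hij

theorem exists_inner_eq {n : ℕ} {b : Fin n → Euc n} (hb : vecDet b ≠ 0) (x : Fin n → ℝ) :
    ∃ u : Euc n, ∀ i, inner ℝ (b i) u = x i := by
  have hli := vecDet_ne_zero_iff.1 hb
  set B := basisOfLinearIndependentOfCardEqFinrank' b hli (by simp)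
  refine ⟨(InnerProductSpace.toDual ℝ (Euc n)).symm
    (LinearMap.toContinuousLinearMap (B.constr ℝ x)), fun i => ?_⟩
  rw [real_inner_comm, InnerProductSpace.toDual_symm_apply]
  have h : B i = b i := by simp [B]
  rw [← h]
  simp

/-- The linear map carrying the basis b to b' has determinant vecDet b' / vecDet b. -/
theorem exists_sl_map {n : ℕ} {b b' : Fin n → Euc n} (hb : vecDet b ≠ 0)
    (h : vecDet b = vecDet b') : ∃ φ : Matrix.SpecialLinearGroup (Fin n) ℝ,
      ∀ i, Matrix.toEuclideanCLM (𝕜 := ℝ) φ.1 (b i) = b' i := by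
  have hli := vecDet_ne_zero_iff.1 hb
  set B := basisOfLinearIndependentOfCardEqFinrank' b hli (by simp)
  have hB : ∀ i, B i = b i := fun i => by simp [B]
  set f : Euc n →ₗ[ℝ] Euc n := B.constr ℝ b'
  have hf : ∀ i, f (b i) = b' i := fun i => by rw [← hB, B.constr_basis]
  set β := (EuclideanSpace.basisFun (Fin n) ℝ).toBasis
  have hdet : LinearMap.det f = 1 := by
    have h1 := β.det_comp f b
    have h2 : (f ∘ b) = b' := funext hf
    rw [h2] at h1
    change vecDet b' = _ * vecDet b at h1
    rw [← h] at h1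
    exact mul_right_cancel₀ hb (by rw [one_mul, ← h1])
  refine ⟨⟨LinearMap.toMatrix β β f, by rw [LinearMap.det_toMatrix, hdet]⟩, fun i => ?_⟩
  rw [← hf, ← ContinuousLinearMap.coe_coe, Matrix.coe_toEuclideanCLM_eq_toEuclideanLin,
    Matrix.toEuclideanLin_eq_toLin_orthonormal, Matrix.toLin_toMatrix]

theorem eq_of_inner_eq {n : ℕ} {b : Fin n → Euc n} (hb : vecDet b ≠ 0) {u v : Euc n}
    (h : ∀ i, inner ℝ (b i) u = inner ℝ (b i) v) : u = v := by
  have hli := vecDet_ne_zero_iff.1 hb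
  refine InnerProductSpace.ext_inner_left_basis
    (basisOfLinearIndependentOfCardEqFinrank' b hli (by simp)) fun i => ?_
  simpa using h i

theorem restr_update {n : ℕ} {s : Finset (Fin n)} {i : Fin n} (hi : i ∈ s) (b : Fin n → Euc n)
    (w : Euc n) : restr s (Function.update b i w) = Function.update (restr s b) i w := by
  funext k
  by_cases h : k = i
  · subst h; simp [restr, hi]
  · simp [restr, h]

theorem restr_erase {n : ℕ} {s : Finset (Fin n)} {i : Fin n} (b : Fin n → Euc n) :
    restr (s.erase i) b = Function.update (restr s b) i 0 := by
  funext k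
  by_cases h : k = i
  · subst h; simp [restr]
  · simp [restr, h]

theorem restr_univ {n : ℕ} (b : Fin n → Euc n) : restr Finset.univ b = b := by
  funext k
  simp [restr]

theorem restr_congr {n : ℕ} {s : Finset (Fin n)} {b b' : Fin n → Euc n} (h : ∀ i ∈ s, b i = b' i) :
    restr s b = restr s b' := by
  funext k
  simp only [restr]
  split_ifs with hk
  · exact h k hk
  · rfl

theorem restr_singleton {n : ℕ} (i : Fin n) (b : Fin n → Euc n) :
    restr {i} b = Pi.single i (b i) := by
  funext k
  by_cases h : k = i
  · subst h; simp [restr]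
  · simp [restr, h]

theorem continuous_restr {n : ℕ} (s : Finset (Fin n)) : Continuous (restr (n := n) s) := by
  refine continuous_pi fun i => ?_
  simp only [restr]
  split_ifs <;> fun_prop

/-! ### Functionals of degree `p` on simplices -/

namespace IsLpFunctional

variable {n : ℕ} {p : ℝ} {g : BodyO n → Euc n → ℝ}

/-- A map in SL(n) carries b to b', and its adjoint carries u' to u because pairings with a basis
determine a direction. The vectors outside s enter the hypotheses but not the simplex, which leaves
freedom to adjust the determinant. -/
theorem apply_restr_congr (hg : IsLpFunctional p g) {b b' : Fin n → Euc n} (hb : vecDet b ≠ 0)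
    (h : vecDet b = vecDet b') {u u' : Euc n} (hu : ∀ i, inner ℝ (b i) u = inner ℝ (b' i) u')
    (s : Finset (Fin n)) : g (simplexBody (restr s b)) u = g (simplexBody (restr s b')) u' := by
  obtain ⟨φ, hφ⟩ := exists_sl_map hb h
  have h1 : simplexBody (restr s b') = slImage φ (simplexBody (restr s b)) := by
    rw [slImage_simplexBody]
    congr 1
    funext i
    simp only [restr]
    split_ifs
    · rw [hφ]
    · rw [map_zero]
  rw [h1, hg.cov]
  congr 1
  refine eq_of_inner_eq hb fun i => ?_
  rw [inner_slAdj, hφ, hu]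

/-- The hyperplane through w and the other vertices splits the simplex in two; the common part has
lost the vertex j. Dual functionals come from the full basis b, although the simplex may be
degenerate. -/
theorem cut_edge (hg : IsLpFunctional p g) {b : Fin n → Euc n} (hb : vecDet b ≠ 0)
    {s : Finset (Fin n)} {i j : Fin n} (hi : i ∈ s) (hj : j ∈ s) (hij : i ≠ j) {c d : ℝ}
    (hc : 0 < c) (hd : 0 < d) (hcd : c + d = 1) {w : Euc n} (hw : w = c • b i + d • b j)
    (u : Euc n) :
    g (simplexBody (restr s b)) u +
        g (simplexBody (restr (s.erase j) (Function.update b i w))) u =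
      g (simplexBody (restr s (Function.update b j w))) u +
        g (simplexBody (restr s (Function.update b i w))) u := by
  have hw' : w = c • restr s b i + d • restr s b j := by simp [restr, hi, hj, hw]
  have hdual : ∀ i ∈ s, ∃ α : Fnl n, α (restr s b i) = 1 ∧ ∀ k, k ≠ i → α (restr s b k) = 0 := by
    intro i hi
    obtain ⟨y, hy⟩ := exists_inner_eq hb (Pi.single i 1)
    refine ⟨(innerSL ℝ y).toLinearMap, ?_, fun k hk => ?_⟩
    · simp [restr, hi, real_inner_comm (b i) y, hy]
    · by_cases hks : k ∈ s <;> simp [restr, hks, real_inner_comm (b k) y, hy, hk]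
  obtain ⟨α, hα1, hα2⟩ := hdual i hi
  obtain ⟨β, hβ1, hβ2⟩ := hdual j hj
  rw [restr_erase, restr_update hi, restr_update hj]
  exact hg.val _ _ _ _ (simplexBody_union hij hc hd hcd hw')
    (simplexBody_inter hij hc hd hw' hα1 hα2 hβ1 hβ2) u

theorem continuous_apply_simplexBody (hg : IsLpFunctional p g) (u : Euc n) {X : Type*}
    [TopologicalSpace X] {f : X → Fin n → Euc n} (hf : Continuous f) :
    Continuous fun x => g (simplexBody (f x)) u :=
  (hg.cont u).comp (continuous_simplexBody.comp hf)

theorem eq_zero_of_forall_ne {F : ℝ → ℝ} (hF : Continuous F) (h : ∀ᶠ t in 𝓝[≠] 0, F t = 0) :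
    F 0 = 0 :=
  tendsto_nhds_unique ((hF.tendsto 0).mono_left nhdsWithin_le_nhds)
    (tendsto_const_nhds.congr' (h.mono fun _ ht => ht.symm))

/-- Shrinking an edge on which the direction vanishes. -/
theorem apply_eq_zero_of_shrink (hg : IsLpFunctional p g) {b : Fin n → Euc n} (hb : vecDet b ≠ 0)
    {s : Finset (Fin n)} {i m : Fin n} (hi : i ∈ s) (hm : m ∉ s) {u : Euc n}
    (hiu : inner ℝ (b i) u = 0) (hmu : inner ℝ (b m) u = 0)
    (hlow : g (simplexBody (restr (s.erase i) b)) u = 0) : g (simplexBody (restr s b)) u = 0 := by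
  have him : m ≠ i := fun h => hm (h ▸ hi)
  have hcont : Continuous fun ε : ℝ =>
      g (simplexBody (restr s (Function.update b i (ε • b i)))) u :=
    hg.continuous_apply_simplexBody u ((continuous_restr s).comp
      (continuous_const.update i (by fun_prop)))
  have hconst : ∀ ε : ℝ, ε ≠ 0 → g (simplexBody (restr s (Function.update b i (ε • b i)))) u =
      g (simplexBody (restr s b)) u := by
    intro ε hε
    -- Scaling b i by ε and the invisible vector b m by ε⁻¹ keeps the determinant, and keeps the
    -- pairings since both vectors are orthogonal to u. The value is therefore constant for ε ≠ 0,
    -- and ε → 0 collapses the simplex onto a face.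
    set b₁ := Function.update b i (ε • b i) with hb₁
    set b₂ := Function.update b₁ m (ε⁻¹ • b₁ m) with hb₂
    have hdet : vecDet b = vecDet b₂ := by
      rw [hb₂, vecDet_update_smul, hb₁, vecDet_update_smul, ← mul_assoc, inv_mul_cancel₀ hε,
        one_mul]
    rw [hg.apply_restr_congr hb hdet (u' := u) (s := s) fun k => ?_]
    · refine congrArg (fun v => g (simplexBody v) u) (restr_congr fun k hk => ?_)
      rw [hb₂, Function.update_of_ne fun h : k = m => hm (h ▸ hk)]
    · by_cases hkm : k = m
      · subst hkm
        simp [hb₂, hb₁, him, inner_smul_left, hmu]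
      · by_cases hki : k = i
        · subst hki
          simp [hb₂, hb₁, hkm, inner_smul_left, hiu]
        · simp [hb₂, hb₁, hkm, hki]
  have h0 : g (simplexBody (restr s (Function.update b i ((0 : ℝ) • b i)))) u = 0 := by
    rw [zero_smul, restr_update hi, ← restr_erase, hlow]
  have h1 := eq_zero_of_forall_ne (F := fun ε : ℝ =>
    g (simplexBody (restr s (Function.update b i (ε • b i)))) u - g (simplexBody (restr s b)) u)
    (hcont.sub continuous_const) (by
      filter_upwards [self_mem_nhdsWithin] with ε hε
      rw [hconst ε hε, sub_self])
  simp only [h0] at h1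
  linarith

/-- The number of vertices in `s` on which a direction does not vanish. -/
def numNonzero (s : Finset (Fin n)) (b : Fin n → Euc n) (u : Euc n) : ℕ :=
  (s.filter fun i => inner ℝ (b i) u ≠ 0).card

theorem numNonzero_update {s : Finset (Fin n)} {b : Fin n → Euc n} {u : Euc n} {i : Fin n}
    (hi : i ∈ s) (hiu : inner ℝ (b i) u ≠ 0) {w : Euc n} (hw : inner ℝ w u = 0) :
    numNonzero s (Function.update b i w) u + 1 = numNonzero s b u := by
  have h : (s.filter fun k => inner ℝ (Function.update b i w k) u ≠ 0) =
      (s.filter fun k => inner ℝ (b k) u ≠ 0).erase i := by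
    ext k
    by_cases hk : k = i
    · subst hk; simp [hw]
    · simp [hk]
  rw [numNonzero, numNonzero, h, Finset.card_erase_add_one (by simp [hi, hiu])]

/-- Two unequal pairings allow a point w orthogonal to u on the line through b i and b j. The edge
relation then links the simplex to two simplices with one nonzero pairing fewer and one of lower
dimension. -/
theorem apply_eq_zero_of_ne (hg : IsLpFunctional p g) {s : Finset (Fin n)} {N : ℕ}
    (hlow : ∀ j ∈ s, ∀ b, vecDet b ≠ 0 → ∀ u, g (simplexBody (restr (s.erase j) b)) u = 0)
    (ih : ∀ b, vecDet b ≠ 0 → ∀ u, numNonzero s b u = N → g (simplexBody (restr s b)) u = 0)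
    {b : Fin n → Euc n} (hb : vecDet b ≠ 0) {u : Euc n} (hN : numNonzero s b u = N + 1)
    {i j : Fin n} (hi : i ∈ s) (hj : j ∈ s) (hij : i ≠ j) (hiu : inner ℝ (b i) u ≠ 0)
    (hju : inner ℝ (b j) u ≠ 0) (hne : inner ℝ (b i) u ≠ inner ℝ (b j) u) :
    g (simplexBody (restr s b)) u = 0 := by
  wlog hle : |inner ℝ (b i) u| ≤ |inner ℝ (b j) u| generalizing i j
  · exact this hj hi hij.symm hju hiu hne.symm (le_of_not_ge hle)
  set x := inner ℝ (b i) u with hx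
  set y := inner ℝ (b j) u with hy
  rcases lt_or_gt_of_ne (mul_ne_zero hiu hju) with hxy | hxy
  -- Opposite signs: w is the point of the edge itself that is orthogonal to u.
  · have hd0 : y - x ≠ 0 := sub_ne_zero.2 hne.symm
    have hc : 0 < y / (y - x) := by
      rcases mul_neg_iff.1 hxy with h | h
      · exact div_pos_of_neg_of_neg h.2 (by linarith)
      · exact div_pos h.2 (by linarith)
    have hd : 0 < -x / (y - x) := by
      rcases mul_neg_iff.1 hxy with h | h
      · exact div_pos_of_neg_of_neg (by linarith) (by linarith)
      · exact div_pos (by linarith) (by linarith)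
    have hcd : y / (y - x) + -x / (y - x) = 1 := by field_simp; ring
    set c := y / (y - x) with hcdef
    set d := -x / (y - x) with hddef
    set w := c • b i + d • b j with hw
    have hwu : inner ℝ w u = 0 := by
      rw [hw, inner_add_left, real_inner_smul_left, real_inner_smul_left, ← hx, ← hy, hcdef, hddef]
      field_simp
      ring
    have h1 : vecDet (Function.update b i w) ≠ 0 := by
      rw [hw, vecDet_update b hij]
      exact mul_ne_zero hc.ne' hb
    have h2 : vecDet (Function.update b j w) ≠ 0 := by
      rw [hw, add_comm, vecDet_update b hij.symm]
      exact mul_ne_zero hd.ne' hb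
    have h3 := hg.cut_edge hb hi hj hij hc hd hcd hw u
    rw [hlow j hj _ h1, ih _ h1 u (by have := numNonzero_update hi hiu hwu; omega),
      ih _ h2 u (by have := numNonzero_update hj hju hwu; omega)] at h3
    linarith
  -- Equal signs: w lies on the line beyond b i. The larger simplex with w in place of b i is cut at
  -- b i, and the given simplex is one of its two parts.
  · have hlt : |x| < |y| := by
      refine lt_of_le_of_ne hle fun h => ?_
      rcases abs_eq_abs.1 h with h | h
      · exact hne h
      · rw [h] at hxy
        nlinarith [sq_nonneg y]
    have hq0 : 0 < x / y := by
      rcases pos_and_pos_or_neg_and_neg_of_mul_pos hxy with h | h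
      · exact div_pos h.1 h.2
      · exact div_pos_of_neg_of_neg h.1 h.2
    have hq1 : x / y < 1 := by
      have : |x / y| < 1 := by rwa [abs_div, div_lt_one (abs_pos.2 hju)]
      exact (abs_lt.1 this).2
    set d := x / y with hd
    have hc : 0 < 1 - d := by linarith
    have hxd : x = d * y := by rw [hd]; field_simp
    set w := (1 - d)⁻¹ • b i + (-((1 - d)⁻¹ * d)) • b j with hw
    have hwu : inner ℝ w u = 0 := by
      rw [hw, inner_add_left, real_inner_smul_left, real_inner_smul_left, ← hx, ← hy, hxd]
      ring
    set b' := Function.update b i w with hb'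
    have hb'0 : vecDet b' ≠ 0 := by
      rw [hb', hw, vecDet_update b hij]
      exact mul_ne_zero (inv_ne_zero hc.ne') hb
    have hb'i : b' i = w := by simp [hb']
    have hb'j : b' j = b j := by simp [hb', hij.symm]
    have hbi : b i = (1 - d) • b' i + d • b' j := by
      rw [hb'i, hb'j, hw, smul_add, smul_smul, smul_smul, mul_inv_cancel₀ hc.ne']
      have : (1 - d) * -((1 - d)⁻¹ * d) = -d := by field_simp
      rw [this]
      module
    have hb'' : Function.update b' i (b i) = b := by simp [hb']
    have h2 : vecDet (Function.update b' j (b i)) ≠ 0 := by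
      rw [hbi, add_comm, vecDet_update b' hij.symm]
      exact mul_ne_zero hq0.ne' hb'0
    have hN' := numNonzero_update (s := s) hi hiu hwu
    have hN'' : numNonzero s (Function.update b' j (b i)) u = numNonzero s b' u := by
      rw [numNonzero, numNonzero]
      congr 1
      refine Finset.filter_congr fun k _ => ?_
      by_cases hk : k = j
      · subst hk
        simp only [Function.update_self, hb'j, ← hx, ← hy]
        exact ⟨fun _ => hju, fun _ => hiu⟩
      · rw [Function.update_of_ne hk]
    have h3 := hg.cut_edge hb'0 hi hj hij hc hq0 (by ring) hbi u
    rw [hb'', hlow j hj _ hb, ih b' hb'0 u (by rw [← hb'] at hN'; omega),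
      ih _ h2 u (by rw [← hb'] at hN'; omega)] at h3
    linarith

theorem vecDet_add_smul_ne_zero {b : Fin n → Euc n} (hb : vecDet b ≠ 0) {j : Fin n} {c : Fin n → ℝ}
    (hc : c j = 0) : vecDet (fun k => b k + c k • b j) ≠ 0 := by
  rw [vecDet_ne_zero_iff] at hb ⊢
  rw [Fintype.linearIndependent_iff] at hb ⊢
  intro f hf
  have h1 : ∑ k, shiftTwo f j j (∑ i, f i * c i) 0 k • b k = 0 := by
    rw [sum_add_single_smul, ← hf]
    simp only [smul_add, Finset.sum_add_distrib, smul_smul, ← Finset.sum_smul]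
    simp
  have h2 := hb _ h1
  have h3 : ∀ k, k ≠ j → f k = 0 := fun k hk => by simpa [shiftTwo, hk] using h2 k
  have h4 : ∑ i, f i * c i = 0 := Finset.sum_eq_zero fun k _ => by
    by_cases hk : k = j
    · rw [hk, hc, mul_zero]
    · rw [h3 k hk, zero_mul]
  intro k
  by_cases hk : k = j
  · subst hk; simpa [shiftTwo, h4] using h2 k
  · exact h3 k hk

/-- Reduction to directions which vanish on all but one vertex. -/
theorem apply_eq_zero_of_single (hg : IsLpFunctional p g) {s : Finset (Fin n)} (hs : s.Nonempty)
    (hlow : s.Nontrivial → ∀ j ∈ s, ∀ b, vecDet b ≠ 0 → ∀ u,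
      g (simplexBody (restr (s.erase j) b)) u = 0)
    (hone : ∀ b, vecDet b ≠ 0 → ∀ u, ∀ j ∈ s, inner ℝ (b j) u ≠ 0 →
      (∀ i, i ≠ j → inner ℝ (b i) u = 0) → g (simplexBody (restr s b)) u = 0)
    {b : Fin n → Euc n} (hb : vecDet b ≠ 0) (u : Euc n) : g (simplexBody (restr s b)) u = 0 := by
  have key : ∀ N : ℕ, ∀ b, vecDet b ≠ 0 → ∀ u, numNonzero s b u = N + 1 →
      g (simplexBody (restr s b)) u = 0 := by
    intro N
    induction N with
    | zero =>
      intro b hb u hN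
      rw [numNonzero, zero_add, Finset.card_eq_one] at hN
      obtain ⟨j, hj⟩ := hN
      have hj' : j ∈ s ∧ inner ℝ (b j) u ≠ 0 := by
        have : j ∈ s.filter fun i => inner ℝ (b i) u ≠ 0 := by rw [hj]; simp
        simpa using this
      have hs0 : ∀ i ∈ s, i ≠ j → inner ℝ (b i) u = 0 := by
        intro i hi hij
        by_contra hcon
        have : i ∈ s.filter fun i => inner ℝ (b i) u ≠ 0 := by simp [hi, hcon]
        rw [hj] at this
        exact hij (by simpa using this)
      -- Vectors outside s are sheared along b j to become orthogonal to u; the simplex does not see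
      -- them.
      set c : Fin n → ℝ := fun k => if k ∈ s then 0 else -(inner ℝ (b k) u / inner ℝ (b j) u)
        with hc
      have hcs : ∀ k ∈ s, c k = 0 := fun k hk => by simp [hc, hk]
      have h1 : restr s b = restr s fun k => b k + c k • b j :=
        restr_congr fun i hi => by simp [hcs i hi]
      rw [h1]
      refine hone _ (vecDet_add_smul_ne_zero hb (hcs j hj'.1)) u j hj'.1 ?_ fun i hij => ?_
      · rw [hcs j hj'.1, zero_smul, add_zero]
        exact hj'.2
      · by_cases hi : i ∈ s
        · rw [hcs i hi, zero_smul, add_zero]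
          exact hs0 i hi hij
        · rw [inner_add_left, real_inner_smul_left]
          simp only [hc, hi, if_false]
          rw [neg_mul, div_mul_cancel₀ _ hj'.2, add_neg_cancel]
    | succ N ih =>
      intro b hb u hN
      have h2 : 1 < (s.filter fun i => inner ℝ (b i) u ≠ 0).card := by
        rw [← numNonzero]; omega
      obtain ⟨i, hi, j, hj, hij⟩ := Finset.one_lt_card.1 h2
      rw [Finset.mem_filter] at hi hj
      have hlow' := hlow ⟨i, hi.1, j, hj.1, hij⟩
      by_cases hne : inner ℝ (b i) u = inner ℝ (b j) u
      -- Equal pairings are separated by moving u along the dual vector of b i; for small t the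
      -- number of nonzero pairings is unchanged, and continuity in u concludes.
      · obtain ⟨y, hy⟩ := exists_inner_eq hb (Pi.single i 1)
        have hpair : ∀ (t : ℝ) k, inner ℝ (b k) (u + t • y) =
            inner ℝ (b k) u + t * (Pi.single i 1 : Fin n → ℝ) k := by
          intro t k
          rw [inner_add_right, inner_smul_right, hy]
        have := eq_zero_of_forall_ne (F := fun t => g (simplexBody (restr s b)) (u + t • y))
          ((hg.cont_dir _).comp (by fun_prop)) (by
            have hev : ∀ᶠ t : ℝ in 𝓝[≠] 0, inner ℝ (b i) u + t ≠ 0 := by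
              refine nhdsWithin_le_nhds (ContinuousAt.eventually_ne (by fun_prop) ?_)
              simpa using hi.2
            filter_upwards [hev, self_mem_nhdsWithin] with t ht ht0
            have hi' : inner ℝ (b i) (u + t • y) = inner ℝ (b i) u + t := by
              rw [hpair]; simp
            have hk' : ∀ k, k ≠ i → inner ℝ (b k) (u + t • y) = inner ℝ (b k) u := by
              intro k hk
              rw [hpair]; simp [hk]
            refine hg.apply_eq_zero_of_ne hlow' ih hb ?_ hi.1 hj.1 hij (by rwa [hi']) ?_ ?_
            · rw [← hN, numNonzero, numNonzero]
              congr 1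
              refine Finset.filter_congr fun k _ => ?_
              by_cases hk : k = i
              · subst hk
                rw [hi']
                exact ⟨fun _ => hi.2, fun _ => ht⟩
              · rw [hk' k hk]
            · rw [hk' j hij.symm]
              exact hj.2
            · rw [hk' j hij.symm, hi', ← hne]
              simpa using ht0)
        simpa using this
      · exact hg.apply_eq_zero_of_ne hlow' ih hb hN hi.1 hj.1 hij hi.2 hj.2 hne
  by_cases hN : numNonzero s b u = 0
  · obtain ⟨i, hi⟩ := hs
    obtain ⟨y, hy⟩ := exists_inner_eq hb (Pi.single i 1)
    have hzero : ∀ k ∈ s, inner ℝ (b k) u = 0 := by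
      intro k hk
      rw [numNonzero, Finset.card_eq_zero, Finset.filter_eq_empty_iff] at hN
      simpa using hN hk
    have := eq_zero_of_forall_ne (F := fun t => g (simplexBody (restr s b)) (u + t • y))
      ((hg.cont_dir _).comp (by fun_prop)) (by
        filter_upwards [self_mem_nhdsWithin] with t ht0
        refine key 0 b hb _ ?_
        rw [numNonzero, zero_add, Finset.card_eq_one]
        refine ⟨i, ?_⟩
        ext k
        rw [Finset.mem_filter, Finset.mem_singleton, inner_add_right, inner_smul_right, hy]
        constructor
        · rintro ⟨hk, h⟩
          by_contra hki
          exact h (by simp [hki, hzero k hk])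
        · rintro rfl
          exact ⟨hi, by simpa [hzero k hi] using ht0⟩)
    simpa using this
  · obtain ⟨N, hN'⟩ := Nat.exists_eq_succ_of_ne_zero hN
    exact key N b hb u hN'

end IsLpFunctional

/-! ### Cauchy's functional equation and vanishing on all simplices -/

theorem eq_zero_of_additive_on_pos {F : ℝ → ℝ} (hF : Continuous F)
    (hadd : ∀ s t, 0 < s → 0 < t → F (s + t) = F s + F t) (h1 : F 1 = 0) {t : ℝ} (ht : 0 < t) :
    F t = 0 := by
  have hmul : ∀ (k : ℕ) (s : ℝ), 0 < s → F ((k + 1 : ℕ) * s) = (k + 1 : ℕ) * F s := by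
    intro k s hs
    induction k with
    | zero => simp
    | succ k ih =>
      have : ((k + 1 + 1 : ℕ) : ℝ) * s = (k + 1 : ℕ) * s + s := by push_cast; ring
      rw [this, hadd _ _ (by positivity) hs, ih]
      push_cast
      ring
  have hrat : ∀ q : ℚ, 0 < q → F q = 0 := by
    intro q hq
    obtain ⟨m, hm⟩ : ∃ m : ℕ, q.num = (m + 1 : ℕ) :=
      ⟨(q.num - 1).toNat, by have := Rat.num_pos.2 hq; omega⟩
    obtain ⟨k, hk⟩ := Nat.exists_eq_succ_of_ne_zero q.den_nz
    have hq' : ((k + 1 : ℕ) : ℝ) * q = (m + 1 : ℕ) * 1 := by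
      have h2 : (q : ℝ) * q.den = q.num := by exact_mod_cast Rat.mul_den_eq_num q
      rw [hk, hm] at h2
      rw [mul_comm, mul_one]
      exact_mod_cast h2
    have h3 := hmul k q (by exact_mod_cast hq)
    rw [hq', hmul m 1 one_pos, h1, mul_zero] at h3
    rcases mul_eq_zero.1 h3.symm with h | h
    · exact absurd h (by positivity)
    · exact h
  by_contra hcon
  obtain ⟨q, hq⟩ := Rat.denseRange_cast (𝕜 := ℝ).exists_mem_open
    ((isOpen_ne_fun hF continuous_const).inter isOpen_Ioi) ⟨t, hcon, ht⟩
  exact hq.1 (hrat q (Rat.cast_pos.1 (Set.mem_Ioi.1 hq.2)))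

namespace IsLpFunctional

variable {n : ℕ} {p : ℝ} {g : BodyO n → Euc n → ℝ}

/-- The standard basis with the vectors at positions `o` and `j` interchanged. -/
def swapVec (o j : Fin n) : Fin n → Euc n := stdVec ∘ Equiv.swap o j

theorem vecDet_swapVec_ne_zero (o j : Fin n) : vecDet (swapVec o j) ≠ 0 := by
  rw [swapVec]
  by_cases h : o = j
  · subst h
    rw [Equiv.swap_self, Equiv.coe_refl, Function.comp_id, vecDet_stdVec]
    exact one_ne_zero
  · rw [vecDet_comp_swap _ h, vecDet_stdVec]
    norm_num

theorem inner_swapVec (o j k : Fin n) (x : ℝ) :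
    inner ℝ (swapVec o j k) (x • stdVec o) = if k = j then x else 0 := by
  rw [inner_smul_right, swapVec, Function.comp_apply, stdVec, stdVec,
    OrthonormalBasis.inner_eq_ite]
  simp [Equiv.swap_apply_eq_iff]

/-- Rescaling a vector b k with k ≠ j changes neither the segment nor the zero pairing of b k with
u, so the determinant can be matched to that of the permuted standard basis. -/
theorem apply_single_eq_zero (hg : IsLpFunctional p g) (hn : 3 ≤ n) {o : Fin n}
    (hseg : ∀ x : ℝ, x ≠ 0 → g (simplexBody (restr {o} stdVec)) (x • stdVec o) = 0)
    {b : Fin n → Euc n} (hb : vecDet b ≠ 0) {u : Euc n} {j : Fin n} (hj : inner ℝ (b j) u ≠ 0)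
    (hzero : ∀ i, i ≠ j → inner ℝ (b i) u = 0) : g (simplexBody (restr {j} b)) u = 0 := by
  have : Nontrivial (Fin n) := Fin.nontrivial_iff_two_le.2 (by omega)
  obtain ⟨k, hk⟩ := exists_ne j
  set b' := Function.update b k ((vecDet (swapVec o j) / vecDet b) • b k) with hb'
  have hdet : vecDet b' = vecDet (swapVec o j) := by
    rw [hb', vecDet_update_smul, div_mul_cancel₀ _ hb]
  have h1 : restr {j} b = restr {j} b' := restr_congr fun i hi => by
    rw [Finset.mem_singleton.1 hi, hb', Function.update_of_ne hk.symm]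
  rw [h1, hg.apply_restr_congr (u' := inner ℝ (b j) u • stdVec o)
    (hdet ▸ vecDet_swapVec_ne_zero o j) hdet]
  · have h2 : restr {j} (swapVec o j) = restr {o} stdVec ∘ Equiv.swap o j := by
      funext i
      simp [restr, swapVec, Equiv.swap_apply_eq_iff]
    rw [h2, simplexBody_comp_perm]
    exact hseg _ hj
  · intro i
    rw [inner_swapVec]
    by_cases hik : i = k
    · subst hik
      rw [if_neg hk, hb', Function.update_self, real_inner_smul_left, hzero i hk, mul_zero]
    · rw [hb', Function.update_of_ne hik]
      split_ifs with hij
      · rw [hij]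
      · exact hzero i hij

/-- With u orthogonal to all vertices but one, the value depends on the determinant alone. It is
additive there, by cutting an edge whose ends k and l are both orthogonal to u; two such vertices
exist because n ≥ 3. -/
theorem apply_full_eq_zero (hg : IsLpFunctional p g) (hn : 3 ≤ n) {o : Fin n}
    (hlow : ∀ j, ∀ b, vecDet b ≠ 0 → ∀ u,
      g (simplexBody (restr (Finset.univ.erase j) b)) u = 0)
    (hfull : ∀ x : ℝ, x ≠ 0 → g (simplexBody stdVec) (x • stdVec o) = 0)
    {b : Fin n → Euc n} (hb : vecDet b ≠ 0) {u : Euc n} {j : Fin n} (hj : inner ℝ (b j) u ≠ 0)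
    (hzero : ∀ i, i ≠ j → inner ℝ (b i) u = 0) : g (simplexBody b) u = 0 := by
  obtain ⟨k, l, hkl, hkj, hlj⟩ : ∃ k l : Fin n, k ≠ l ∧ k ≠ j ∧ l ≠ j := by
    have hcard : 1 < (Finset.univ.erase j).card := by
      rw [Finset.card_erase_of_mem (Finset.mem_univ j), Finset.card_univ, Fintype.card_fin]
      omega
    obtain ⟨k, hk, l, hl, hkl⟩ := Finset.one_lt_card.1 hcard
    exact ⟨k, l, hkl, Finset.ne_of_mem_erase hk, Finset.ne_of_mem_erase hl⟩
  set c := swapVec o j with hc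
  have hc0 : vecDet c ≠ 0 := vecDet_swapVec_ne_zero o j
  set u' := inner ℝ (b j) u • stdVec o with hu'
  have hcu : ∀ i, inner ℝ (c i) u' = if i = j then inner ℝ (b j) u else 0 := fun i =>
    inner_swapVec o j i _
  -- Vertex k runs along the line from c l at t = 0 to c k at t = 1. The determinant is t times that
  -- of c and the pairings with u' stay fixed. Since C s k lies between c l and C (s + t) k, cutting
  -- there leaves determinants proportional to s and t.
  set C : ℝ → Fin n → Euc n := fun t => Function.update c k (t • c k + (1 - t) • c l) with hC
  have hCdet : ∀ t, vecDet (C t) = t * vecDet c := fun t => vecDet_update c hkl t _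
  have hCk : ∀ t, C t k = t • c k + (1 - t) • c l := fun t => by simp [hC]
  have hCi : ∀ t i, i ≠ k → C t i = c i := fun t i hi => by simp [hC, hi]
  have hCu : ∀ t i, inner ℝ (C t i) u' = if i = j then inner ℝ (b j) u else 0 := by
    intro t i
    by_cases hik : i = k
    · subst hik
      rw [hCk, inner_add_left, real_inner_smul_left, real_inner_smul_left, hcu, hcu, if_neg hkj,
        if_neg hlj]
      simp
    · rw [hCi t i hik, hcu]
  have hFc : Continuous fun t => g (simplexBody (C t)) u' :=
    hg.continuous_apply_simplexBody u' (continuous_const.update k (by fun_prop))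
  have hF1 : g (simplexBody (C 1)) u' = 0 := by
    have h1 : C 1 = c := by
      funext i
      by_cases hik : i = k
      · subst hik; simp [hCk]
      · exact hCi 1 i hik
    rw [h1, hc, swapVec, simplexBody_comp_perm]
    exact hfull _ hj
  have hadd : ∀ s t, 0 < s → 0 < t →
      g (simplexBody (C (s + t))) u' = g (simplexBody (C s)) u' + g (simplexBody (C t)) u' := by
    intro s t hs ht
    have hst : s + t ≠ 0 := (add_pos hs ht).ne'
    have hdet : vecDet (C (s + t)) ≠ 0 := by
      rw [hCdet]
      exact mul_ne_zero hst hc0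
    have hw : C s k = (s / (s + t)) • C (s + t) k + (t / (s + t)) • C (s + t) l := by
      rw [hCk, hCk, hCi _ l hkl.symm, smul_add, smul_smul, smul_smul, div_mul_cancel₀ _ hst,
        add_assoc, ← add_smul]
      congr 2
      field_simp
      ring
    have h1 := hg.cut_edge hdet (Finset.mem_univ k) (Finset.mem_univ l) hkl
      (div_pos hs (add_pos hs ht)) (div_pos ht (add_pos hs ht)) (by field_simp) hw u'
    have h2 : Function.update (C (s + t)) k (C s k) = C s := by
      funext i
      by_cases hik : i = k
      · subst hik; simp
      · rw [Function.update_of_ne hik, hCi _ i hik, hCi _ i hik]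
    have h3 : vecDet (Function.update (C (s + t)) l (C s k)) = vecDet (C t) := by
      rw [hw, add_comm ((s / (s + t)) • _), vecDet_update _ hkl.symm, hCdet, hCdet]
      field_simp
    have h4 : vecDet (Function.update (C (s + t)) l (C s k)) ≠ 0 := by
      rw [h3, hCdet]
      exact mul_ne_zero ht.ne' hc0
    rw [h2, hlow l _ (by rw [hCdet]; exact mul_ne_zero hs.ne' hc0),
      hg.apply_restr_congr h4 h3 (u' := u')] at h1
    · simp only [restr_univ] at h1
      linarith
    · intro i
      by_cases hil : i = l
      · subst hil
        rw [Function.update_self, hCu, hCu, if_neg hkj, if_neg hlj]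
      · rw [Function.update_of_ne hil, hCu, hCu]
  have hF : ∀ t, 0 < t → g (simplexBody (C t)) u' = 0 := fun t ht =>
    eq_zero_of_additive_on_pos hFc hadd hF1 ht
  have key : ∀ b : Fin n → Euc n, 0 < vecDet b / vecDet c →
      (∀ i, inner ℝ (b i) u = inner ℝ (c i) u') → g (simplexBody b) u = 0 := by
    intro b hr hbu
    have hdet : vecDet b = vecDet (C (vecDet b / vecDet c)) := by
      rw [hCdet, div_mul_cancel₀ _ hc0]
    have hb : vecDet b ≠ 0 := fun h => by simp [h] at hr
    have h1 := hg.apply_restr_congr hb hdet (u := u) (u' := u')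
      (fun i => by rw [hbu, hcu, hCu]) Finset.univ
    rw [restr_univ, restr_univ] at h1
    rw [h1]
    exact hF _ hr
  have hbu : ∀ i, inner ℝ (b i) u = inner ℝ (c i) u' := by
    intro i
    rw [hcu]
    split_ifs with hij
    · rw [hij]
    · exact hzero i hij
  -- A determinant of the wrong sign is corrected by exchanging the vertices k and l, which
  -- preserves simplex and pairings.
  rcases lt_or_gt_of_ne (div_ne_zero hb hc0) with hr | hr
  · rw [← simplexBody_comp_perm (Equiv.swap k l)]
    refine key _ ?_ fun i => ?_
    · rw [vecDet_comp_swap _ hkl, neg_div]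
      linarith
    · rw [Function.comp_apply, ← hbu]
      by_cases hik : i = k
      · rw [hik, Equiv.swap_apply_left, hzero l hlj, hzero k hkj]
      · by_cases hil : i = l
        · rw [hil, Equiv.swap_apply_right, hzero l hlj, hzero k hkj]
        · rw [Equiv.swap_apply_of_ne_of_ne hik hil]
  · exact key b hr hbu

/-- A functional of degree `p` vanishes on all simplices with a vertex at the origin as soon as it
vanishes for a standard segment and the standard simplex in the directions `± eₒ`. -/
theorem apply_simplexBody_eq_zero (hg : IsLpFunctional p g) (hn : 3 ≤ n) {o : Fin n}
    (hseg : ∀ x : ℝ, x ≠ 0 → g (simplexBody (restr {o} stdVec)) (x • stdVec o) = 0)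
    (hfull : ∀ x : ℝ, x ≠ 0 → g (simplexBody stdVec) (x • stdVec o) = 0) (s : Finset (Fin n)) :
    ∀ b, vecDet b ≠ 0 → ∀ u, g (simplexBody (restr s b)) u = 0 := by
  -- Segments come before the body {0}: erasing the only vertex would require the value on {0},
  -- which is known only afterwards as a limit of segments. Hence the nontriviality condition in
  -- `apply_eq_zero_of_single`.
  have hsingle : ∀ j, ∀ b, vecDet b ≠ 0 → ∀ u, g (simplexBody (restr {j} b)) u = 0 := by
    intro j b hb u
    refine hg.apply_eq_zero_of_single (Finset.singleton_nonempty j)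
      (fun h => absurd h (by simp)) (fun b hb u i hi hiu hzero => ?_) hb u
    rw [Finset.mem_singleton] at hi
    subst hi
    exact hg.apply_single_eq_zero hn hseg hb hiu hzero
  induction hk : s.card using Nat.strong_induction_on generalizing s with
  | _ k ih =>
  intro b hb u
  rcases s.eq_empty_or_nonempty with rfl | hs
  · have h1 := eq_zero_of_forall_ne
      (F := fun ε : ℝ => g (simplexBody (restr {o} (Function.update b o (ε • b o)))) u)
      (hg.continuous_apply_simplexBody u ((continuous_restr {o}).comp
        (continuous_const.update o (by fun_prop)))) (by
        filter_upwards [self_mem_nhdsWithin] with ε hε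
        refine hsingle o _ ?_ u
        rw [vecDet_update_smul]
        exact mul_ne_zero hε hb)
    rw [zero_smul, restr_singleton, Function.update_self, Pi.single_zero] at h1
    have h2 : restr ∅ b = 0 := by
      funext i
      simp [restr]
    rw [h2]
    exact h1
  · have hlow : ∀ j ∈ s, ∀ b, vecDet b ≠ 0 → ∀ u,
        g (simplexBody (restr (s.erase j) b)) u = 0 := fun j hj =>
      ih _ (hk ▸ Finset.card_erase_lt_of_mem hj) _ rfl
    refine hg.apply_eq_zero_of_single hs (fun _ => hlow) (fun b hb u j hj hju hzero => ?_) hb u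
    by_cases huniv : s = Finset.univ
    · subst huniv
      rw [restr_univ]
      exact hg.apply_full_eq_zero hn (fun j => hlow j (Finset.mem_univ j)) hfull hb hju hzero
    · obtain ⟨m, hm⟩ : ∃ m, m ∉ s := by
        by_contra! hcon
        exact huniv (Finset.eq_univ_iff_forall.2 hcon)
      by_cases hsj : s = {j}
      · rw [hsj]
        exact hsingle j b hb u
      · obtain ⟨i, hi, hij⟩ : ∃ i ∈ s, i ≠ j := by
          by_contra! hcon
          exact hsj (Finset.eq_singleton_iff_unique_mem.2 ⟨hj, hcon⟩)
        exact hg.apply_eq_zero_of_shrink hb hi hm (hzero i hij)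
          (hzero m fun h => hm (h ▸ hj)) (hlow i hi b hb u)

/-- Uniqueness: a functional of degree `p` is zero as soon as it vanishes for a standard segment
and the standard simplex in the directions `± eₒ`. -/
theorem eq_zero (hg : IsLpFunctional p g) (hn : 3 ≤ n) {o : Fin n}
    (hseg : ∀ x : ℝ, x ≠ 0 → g (simplexBody (restr {o} stdVec)) (x • stdVec o) = 0)
    (hfull : ∀ x : ℝ, x ≠ 0 → g (simplexBody stdVec) (x • stdVec o) = 0) (K : BodyO n)
    (u : Euc n) : g K u = 0 :=
  IsVal.eq_zero_of_simplexBody (g := fun K => g K u)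
    (fun K L U I hU hI => hg.val K L U I hU hI u) (hg.cont u)
    (fun b hb s => hg.apply_simplexBody_eq_zero hn hseg hfull s b (vecDet_ne_zero_iff.2 hb) u) K

end IsLpFunctional

/-! ### Moment functionals -/

/-- The `p`-th power of the support function of the asymmetric moment body. -/
def momentFun {n : ℕ} (p : ℝ) (K : BodyO n) (u : Euc n) : ℝ :=
  ∫ x in K.toSet, (max 0 (inner ℝ x u)) ^ p

theorem supportFun_momentPlus_rpow {n : ℕ} {p : ℝ} (hp : 1 < p) (K : BodyO n) (u : Euc n) :
    supportFun (momentPlus p K.1).1 u ^ p = momentFun p K u :=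
  supportFun_momentPlus hp K.1 u

theorem supportFun_momentMinus_rpow {n : ℕ} {p : ℝ} (hp : 1 < p) (K : BodyO n) (u : Euc n) :
    supportFun (momentMinus p K.1).1 u ^ p = momentFun p K (-u) := by
  rw [supportFun_momentMinus hp, momentFun]
  simp only [inner_neg_right]
  rfl

theorem continuous_momentIntegrand {n : ℕ} {p : ℝ} (hp : 1 < p) (u : Euc n) :
    Continuous fun x : Euc n => (max 0 (inner ℝ x u)) ^ p :=
  (Real.continuous_rpow_const (by linarith)).comp (continuous_const.max (by fun_prop))

theorem measurableSet_toSet {n : ℕ} (K : BodyO n) : MeasurableSet K.toSet :=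
  K.1.isClosed.measurableSet

theorem integrableOn_momentIntegrand {n : ℕ} {p : ℝ} (hp : 1 < p) (K : BodyO n) (u : Euc n) :
    IntegrableOn (fun x : Euc n => (max 0 (inner ℝ x u)) ^ p) K.toSet :=
  (continuous_momentIntegrand hp u).continuousOn.integrableOn_compact K.1.isCompact

/-- If K within distance r of K₀ missed x, a unit vector u would separate them; then x + r u ∈ K₀
makes h(K₀, u) exceed h(K, u) by at least r. -/
theorem eventually_mem_of_mem_interior {n : ℕ} {K₀ : BodyO n} {x : Euc n}
    (hx : x ∈ interior K₀.toSet) : ∀ᶠ K in 𝓝 K₀, x ∈ K.toSet := by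
  obtain ⟨r, hr, hball⟩ := Metric.nhds_basis_closedBall.mem_iff.1 (mem_interior_iff_mem_nhds.1 hx)
  filter_upwards [Metric.ball_mem_nhds K₀ hr] with K hK
  by_contra hxK
  obtain ⟨u, hu, y, -, hxy⟩ := exists_separating_direction K.1 hxK
  have h1 : x + r • u ∈ K₀.toSet := hball (by
    rw [Metric.mem_closedBall, dist_self_add_left, norm_smul, hu, Real.norm_eq_abs, abs_of_pos hr,
      mul_one])
  have h2 := inner_le_supportFun K₀.1 h1 u
  rw [inner_add_left, real_inner_smul_left, real_inner_self_eq_norm_sq, hu] at h2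
  have h3 := supportFun_le_add_dist K₀.1 K.1 u
  rw [hu, mul_one] at h3
  have h4 : dist K₀.1 K.1 < r := by
    rw [← Subtype.dist_eq, dist_comm]
    exact hK
  have := dist_nonneg (x := x) (y := y)
  linarith

theorem eventually_notMem_of_notMem {n : ℕ} {K₀ : BodyO n} {x : Euc n} (hx : x ∉ K₀.toSet) :
    ∀ᶠ K in 𝓝 K₀, x ∉ K.toSet := by
  have hpos : 0 < Metric.infDist x K₀.toSet :=
    (K₀.1.isClosed.notMem_iff_infDist_pos K₀.1.nonempty).1 hx
  filter_upwards [Metric.ball_mem_nhds K₀ hpos] with K hK hxK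
  have h1 : Metric.infDist x K₀.toSet ≤ Metric.hausdorffDist K.toSet K₀.toSet :=
    Metric.infDist_le_hausdorffDist_of_mem hxK ConvexBody.hausdorffEDist_ne_top
  exact absurd (lt_of_le_of_lt h1 hK) (lt_irrefl _)

/-- Dominated convergence: indicators converge off the boundary of the limit body, which is null by
convexity, and nearby bodies lie in one ball. -/
theorem continuous_momentFun {n : ℕ} {p : ℝ} (hp : 1 < p) (u : Euc n) :
    Continuous fun K : BodyO n => momentFun p K u := by
  rw [continuous_iff_continuousAt]
  intro K₀
  obtain ⟨R, hR0, hR⟩ := exists_norm_le K₀.1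
  set F : Euc n → ℝ := fun x => (max 0 (inner ℝ x u)) ^ p with hF
  have hF0 : ∀ x, 0 ≤ F x := fun x => Real.rpow_nonneg (le_max_left _ _) _
  have hFc : Continuous F := continuous_momentIntegrand hp u
  have hind : ∀ K : BodyO n, momentFun p K u = ∫ x, K.toSet.indicator F x := fun K =>
    (integral_indicator (measurableSet_toSet K)).symm
  simp only [ContinuousAt, hind]
  refine tendsto_integral_filter_of_dominated_convergence
    ((Metric.closedBall (0 : Euc n) (R + 1)).indicator F) ?_ ?_ ?_ ?_
  · exact Eventually.of_forall fun K =>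
      (hFc.measurable.indicator (measurableSet_toSet K)).aestronglyMeasurable
  · filter_upwards [Metric.ball_mem_nhds K₀ one_pos] with K hK
    refine Eventually.of_forall fun x => ?_
    have hsub : K.toSet ⊆ Metric.closedBall (0 : Euc n) (R + 1) := by
      intro x hx
      obtain ⟨y, hy, hxy⟩ := Metric.exists_dist_lt_of_hausdorffDist_lt (t := K₀.toSet) hx hK
        ConvexBody.hausdorffEDist_ne_top
      rw [mem_closedBall_zero_iff]
      have h1 := norm_le_norm_add_norm_sub y x
      rw [norm_sub_rev, ← dist_eq_norm] at h1
      have := hR y hy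
      linarith
    rw [Real.norm_eq_abs, abs_of_nonneg (Set.indicator_nonneg (fun x _ => hF0 x) x)]
    exact Set.indicator_le_indicator_of_subset hsub hF0 x
  · rw [integrable_indicator_iff measurableSet_closedBall]
    exact hFc.continuousOn.integrableOn_compact (isCompact_closedBall _ _)
  · have hfr : volume (frontier K₀.toSet) = 0 := K₀.1.convex.addHaar_frontier volume
    filter_upwards [measure_eq_zero_iff_ae_notMem.1 hfr] with x hx
    refine tendsto_const_nhds.congr' ?_
    by_cases hxK : x ∈ K₀.toSet
    · have hint : x ∈ interior K₀.toSet := by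
        by_contra hcon
        exact hx ⟨subset_closure hxK, hcon⟩
      filter_upwards [eventually_mem_of_mem_interior hint] with K hK
      rw [Set.indicator_of_mem hxK, Set.indicator_of_mem hK]
    · filter_upwards [eventually_notMem_of_notMem hxK] with K hK
      rw [Set.indicator_of_notMem hxK, Set.indicator_of_notMem hK]

theorem det_toEuclideanCLM {n : ℕ} (φ : Matrix.SpecialLinearGroup (Fin n) ℝ) :
    (Matrix.toEuclideanCLM (𝕜 := ℝ) φ.1).det = 1 := by
  rw [ContinuousLinearMap.det, Matrix.coe_toEuclideanCLM_eq_toEuclideanLin,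
    Matrix.toEuclideanLin_eq_toLin_orthonormal, LinearMap.det_toLin, φ.2]

theorem injective_toEuclideanCLM {n : ℕ} (φ : Matrix.SpecialLinearGroup (Fin n) ℝ) :
    Function.Injective (Matrix.toEuclideanCLM (𝕜 := ℝ) φ.1) := by
  refine Function.LeftInverse.injective (g := Matrix.toEuclideanCLM (𝕜 := ℝ) (φ⁻¹).1) fun x => ?_
  rw [← mul_apply_eq_comp, ← map_mul, ← Matrix.SpecialLinearGroup.coe_mul,
    inv_mul_cancel, Matrix.SpecialLinearGroup.coe_one, map_one]
  rfl

theorem isLpFunctional_momentFun {n : ℕ} {p : ℝ} (hp : 1 < p) :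
    IsLpFunctional (n := n) p (momentFun p) where
  cont := continuous_momentFun hp
  cont_dir K := by
    simp only [funext fun u => (supportFun_momentPlus_rpow hp K u).symm]
    exact (isLpFunctional_supportFun hp).cont_dir (momentPlus p K.1)
  cov φ K u := by
    have h := integral_image_eq_integral_abs_det_fderiv_smul volume (measurableSet_toSet K)
      (fun x _ => (Matrix.toEuclideanCLM (𝕜 := ℝ) φ.1).hasFDerivWithinAt)
      (injective_toEuclideanCLM φ).injOn (fun x : Euc n => (max 0 (inner ℝ x u)) ^ p)
    simp only [det_toEuclideanCLM, abs_one, one_smul, ← inner_slAdj] at h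
    exact h
  hom K c hc u := by
    simp only [← supportFun_momentPlus_rpow hp]
    exact (isLpFunctional_supportFun hp).hom (momentPlus p K.1) c hc u
  val K L U I hU hI u := by
    have hind : ∀ K : BodyO n, Integrable (K.toSet.indicator
        fun x : Euc n => (max 0 (inner ℝ x u)) ^ p) := fun K =>
      (integrable_indicator_iff (measurableSet_toSet K)).2 (integrableOn_momentIntegrand hp K u)
    simp only [momentFun, ← integral_indicator (measurableSet_toSet _)]
    rw [← integral_add (hind U) (hind I), ← integral_add (hind K) (hind L), hU, hI]
    exact integral_congr_ae (Eventually.of_forall fun x =>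
      congrFun (Set.indicator_union_add_inter _ K.toSet L.toSet) x)

theorem momentFun_segment {n : ℕ} (hn : 2 ≤ n) (p : ℝ) (o : Fin n) (u : Euc n) :
    momentFun p (simplexBody (restr {o} stdVec)) u = 0 := by
  refine setIntegral_measure_zero _ (measure_mono_null (t := (ℝ ∙ stdVec o : Submodule ℝ (Euc n)))
    ?_ (Measure.addHaar_submodule _ _ ?_))
  · rintro _ ⟨t, -, -, rfl⟩
    rw [restr_singleton]
    refine Submodule.sum_mem _ fun i _ => Submodule.smul_mem _ _ ?_
    by_cases hi : i = o
    · subst hi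
      rw [Pi.single_eq_same]
      exact Submodule.mem_span_singleton_self _
    · rw [Pi.single_eq_of_ne hi]
      exact Submodule.zero_mem _
  · intro h
    have h1 := finrank_span_le_card (R := ℝ) ({stdVec o} : Set (Euc n))
    rw [h, finrank_top, finrank_euclideanSpace_fin] at h1
    simp at h1
    omega

theorem sum_smul_stdVec {n : ℕ} (t : Fin n → ℝ) (o : Fin n) :
    inner ℝ (∑ i, t i • stdVec i) (stdVec o) = t o := by
  rw [sum_inner, Finset.sum_eq_single o]
  · rw [real_inner_smul_left, stdVec, OrthonormalBasis.inner_eq_ite, if_pos rfl, mul_one]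
  · intro i _ hi
    rw [real_inner_smul_left, stdVec, stdVec, OrthonormalBasis.inner_eq_ite, if_neg hi, mul_zero]
  · simp

theorem momentFun_simplex_neg {n : ℕ} {p : ℝ} (hp : 1 < p) (o : Fin n) {s : ℝ} (hs : 0 ≤ s) :
    momentFun p (simplexBody fun i => s • stdVec i) (-stdVec o) = 0 := by
  refine setIntegral_eq_zero_of_forall_eq_zero ?_
  rintro _ ⟨t, ht, -, rfl⟩
  simp only [smul_smul]
  rw [inner_neg_right, sum_smul_stdVec (fun i => t i * s), max_eq_left (by
    have := ht o
    have : 0 ≤ t o * s := by positivity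
    linarith), Real.zero_rpow (by linarith)]

theorem momentFun_simplex_pos {n : ℕ} {p : ℝ} (hp : 1 < p) (o : Fin n) :
    0 < momentFun p (simplexBody stdVec) (stdVec o) := by
  rw [momentFun, setIntegral_pos_iff_support_of_nonneg_ae
    (Eventually.of_forall fun x => Real.rpow_nonneg (le_max_left _ _) _)
    (integrableOn_momentIntegrand hp _ _)]
  set V : Set (Euc n) := {x | (∀ i, 0 < x i) ∧ ∑ i, x i < 1} with hV
  have hVo : IsOpen V := by
    have h1 : IsOpen {x : Euc n | ∀ i, 0 < x i} := by
      rw [Set.ofPred_forall]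
      exact isOpen_iInter_of_finite fun i => isOpen_lt continuous_const (by fun_prop)
    have h2 : IsOpen {x : Euc n | ∑ i, x i < 1} := isOpen_lt (by fun_prop) continuous_const
    exact h1.inter h2
  have hn : (0 : ℝ) < n := by exact_mod_cast o.pos
  have hVn : V.Nonempty := by
    refine ⟨WithLp.toLp 2 fun _ => 1 / (n + 1 : ℝ), fun i => ?_, ?_⟩
    · simp only
      positivity
    · simp only [Finset.sum_const, Finset.card_univ, Fintype.card_fin, nsmul_eq_mul]
      rw [mul_one_div, div_lt_one (by positivity)]
      linarith
  refine lt_of_lt_of_le (hVo.measure_pos volume hVn) (measure_mono ?_)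
  rintro x ⟨hx0, hx1⟩
  have hx : x = ∑ i, x i • stdVec i := by
    have := (EuclideanSpace.basisFun (Fin n) ℝ).sum_repr x
    simpa using this.symm
  refine ⟨?_, ⟨x, fun i => (hx0 i).le, hx1.le, hx⟩⟩
  rw [Function.mem_support, hx, sum_smul_stdVec]
  exact (Real.rpow_pos_of_pos (lt_max_of_lt_right (hx0 o)) p).ne'

/-- The degree n + p, against p for the powers of support functions, is what later separates the
signs of the coefficients. -/
theorem momentFun_simplex_smul {n : ℕ} (p : ℝ) (o : Fin n) {s : ℝ} (hs : 0 < s) :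
    momentFun p (simplexBody fun i => s • stdVec i) (stdVec o) =
      s ^ n * s ^ p * momentFun p (simplexBody stdVec) (stdVec o) := by
  have hset : (simplexBody fun i : Fin n => s • stdVec i).toSet =
      s • (simplexBody stdVec).toSet := by
    ext x
    constructor
    · rintro ⟨t, ht, ht1, rfl⟩
      refine ⟨_, ⟨t, ht, ht1, rfl⟩, ?_⟩
      simp only [Finset.smul_sum]
      exact Finset.sum_congr rfl fun i _ => smul_comm _ _ _
    · rintro ⟨_, ⟨t, ht, ht1, rfl⟩, rfl⟩
      refine ⟨t, ht, ht1, ?_⟩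
      simp only [Finset.smul_sum]
      exact Finset.sum_congr rfl fun i _ => smul_comm _ _ _
  have h := Measure.setIntegral_comp_smul (volume : Measure (Euc n))
    (fun x => (max 0 (inner ℝ x (stdVec o))) ^ p) (simplexBody stdVec).toSet hs.ne'
  have h1 : ∀ x : Euc n, (max 0 (inner ℝ (s • x) (stdVec o))) ^ p =
      s ^ p * (max 0 (inner ℝ x (stdVec o))) ^ p := fun x => by
    rw [real_inner_smul_left, ← Real.mul_rpow hs.le (le_max_left _ _), mul_max_of_nonneg _ _ hs.le,
      mul_zero]
  simp only [h1] at h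
  rw [integral_const_mul, finrank_euclideanSpace_fin, abs_of_pos (by positivity), smul_eq_mul,
    ← hset] at h
  change s ^ p * momentFun p (simplexBody stdVec) (stdVec o) = (s ^ n)⁻¹ * momentFun p _ _ at h
  rw [mul_assoc, h, ← mul_assoc, mul_inv_cancel₀ (by positivity), one_mul]

/-! ### Classification of functionals of degree `p` -/

theorem supportFun_simplexBody_le {n : ℕ} {v : Fin n → Euc n} {u : Euc n} {c : ℝ} (hc : 0 ≤ c)
    (h : ∀ i, inner ℝ (v i) u ≤ c) : supportFun (simplexBody v).1 u ≤ c := by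
  refine supportFun_le ?_
  rintro _ ⟨t, ht, ht1, rfl⟩
  rw [sum_inner]
  calc ∑ i, inner ℝ (t i • v i) u ≤ ∑ i, t i * c := Finset.sum_le_sum fun i _ => by
        rw [real_inner_smul_left]
        exact mul_le_mul_of_nonneg_left (h i) (ht i)
    _ ≤ 1 * c := by
      rw [← Finset.sum_mul]
      gcongr
    _ = c := one_mul c

theorem inner_le_supportFun_simplexBody {n : ℕ} (v : Fin n → Euc n) (i : Fin n) (u : Euc n) :
    inner ℝ (v i) u ≤ supportFun (simplexBody v).1 u := by
  have hi : v i ∈ (simplexBody v).toSet := by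
    refine ⟨Pi.single i 1, fun k => ?_, by simp, by simp [Pi.single_apply, ite_smul]⟩
    by_cases hk : k = i
    · subst hk; simp
    · simp [hk]
  exact inner_le_supportFun _ hi u

theorem inner_stdVec {n : ℕ} (i o : Fin n) :
    inner ℝ (stdVec i) (stdVec o) = if i = o then (1 : ℝ) else 0 :=
  OrthonormalBasis.inner_eq_ite _ _ _

theorem supportFun_simplex {n : ℕ} (o : Fin n) {s : ℝ} (hs : 0 ≤ s) :
    supportFun (simplexBody fun i => s • stdVec i).1 (stdVec o) = s := by
  apply le_antisymm
  · refine supportFun_simplexBody_le hs fun i => ?_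
    rw [real_inner_smul_left, inner_stdVec]
    split_ifs <;> simp [hs]
  · refine le_trans (le_of_eq ?_) (inner_le_supportFun_simplexBody _ o _)
    rw [real_inner_smul_left, inner_stdVec, if_pos rfl, mul_one]

theorem supportFun_simplex_neg {n : ℕ} (o : Fin n) {s : ℝ} (hs : 0 ≤ s) :
    supportFun (simplexBody fun i => s • stdVec i).1 (-stdVec o) = 0 := by
  refine le_antisymm (supportFun_simplexBody_le le_rfl fun i => ?_) (supportFun_nonneg _ _)
  rw [inner_neg_right, real_inner_smul_left, inner_stdVec]
  split_ifs <;> simp [hs]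

theorem supportFun_segment {n : ℕ} (o : Fin n) :
    supportFun (simplexBody (restr {o} stdVec)).1 (stdVec o) = 1 := by
  apply le_antisymm
  · refine supportFun_simplexBody_le zero_le_one fun i => ?_
    by_cases hi : i = o <;> simp [restr, hi]
  · refine le_trans (le_of_eq ?_) (inner_le_supportFun_simplexBody _ o _)
    simp [restr]

theorem supportFun_segment_neg {n : ℕ} (o : Fin n) :
    supportFun (simplexBody (restr {o} stdVec)).1 (-stdVec o) = 0 := by
  refine le_antisymm (supportFun_simplexBody_le le_rfl fun i => ?_) (supportFun_nonneg _ _)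
  by_cases hi : i = o <;> simp [restr, hi]

theorem nonneg_of_forall_pow {n : ℕ} (hn : n ≠ 0) {a c : ℝ} (hc : 0 ≤ c)
    (h : ∀ s : ℝ, 0 < s → 0 ≤ a * s ^ n + c) : 0 ≤ a := by
  by_contra! ha
  -- At s = 1 + c / (-a) ≥ 1 one has a s^n ≤ a s = a - c, so the assumed nonnegative quantity is at
  -- most a < 0.
  have hs : 1 ≤ 1 + c / -a := by
    have : 0 ≤ c / -a := div_nonneg hc (by linarith)
    linarith
  have h1 := h _ (lt_of_lt_of_le one_pos hs)
  have h2 : a * (1 + c / -a) ^ n ≤ a * (1 + c / -a) :=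
    mul_le_mul_of_nonpos_left (le_self_pow₀ hs hn) ha.le
  have h3 : a * (1 + c / -a) = a - c := by
    have : a ≠ 0 := ha.ne
    field_simp
    ring
  linarith

theorem IsLpFunctional.apply_smul_eq_zero {n : ℕ} {p : ℝ} (hp : 1 < p) {g : BodyO n → Euc n → ℝ}
    (hg : IsLpFunctional p g) {K : BodyO n} {u : Euc n} (h : g K u = 0) (h' : g K (-u) = 0)
    (x : ℝ) : g K (x • u) = 0 := by
  rcases lt_trichotomy x 0 with hx | rfl | hx
  · have : x • u = (-x) • (-u) := by rw [smul_neg, neg_smul, neg_neg]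
    rw [this, hg.hom K _ (neg_pos.2 hx), h', mul_zero]
  · rw [zero_smul, hg.apply_zero hp]
  · rw [hg.hom K _ hx, h, mul_zero]

/-- Nonnegative functionals of degree `p` are combinations of the four standard ones. -/
theorem IsLpFunctional.exists_eq {n : ℕ} (hn : 3 ≤ n) {p : ℝ} (hp : 1 < p)
    {f : BodyO n → Euc n → ℝ} (hf : IsLpFunctional p f) (hf0 : ∀ K u, 0 ≤ f K u) :
    ∃ a b c d : ℝ, 0 ≤ a ∧ 0 ≤ b ∧ 0 ≤ c ∧ 0 ≤ d ∧ ∀ K u,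
      f K u = a * momentFun p K u + b * momentFun p K (-u) + c * supportFun K.1 u ^ p +
        d * supportFun K.1 (-u) ^ p := by
  have hp0 : p ≠ 0 := by linarith
  let o : Fin n := ⟨0, by omega⟩
  set e : Euc n := stdVec o with he
  set I : BodyO n := simplexBody (restr {o} stdVec) with hI
  set T : ℝ → BodyO n := fun s => simplexBody fun i => s • stdVec i with hT
  have hT1 : simplexBody stdVec = T 1 := by simp only [hT, one_smul]
  set m := momentFun p (T 1) e with hm
  have hm0 : 0 < m := by
    rw [hm, ← hT1]
    exact momentFun_simplex_pos hp o
  set c := f I e with hc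
  set d := f I (-e) with hd
  -- The linear system is triangular: on I the moments vanish and h(I, ±e) is 1 or 0, which gives c
  -- and d; on T 1 the equations read f(T 1, e) = a m + c and f(T 1, -e) = b m + d.
  set a := (f (T 1) e - c) / m with ha
  set b := (f (T 1) (-e) - d) / m with hb
  have hM := isLpFunctional_momentFun (n := n) hp
  have hH := isLpFunctional_supportFun (n := n) hp
  have hTm : ∀ s, 0 < s → momentFun p (T s) e = s ^ n * s ^ p * m := fun s hs => by
    rw [hm, ← hT1]
    exact momentFun_simplex_smul p o hs
  have hTm' : ∀ s, 0 < s → momentFun p (T s) (-e) = 0 := fun s hs =>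
    momentFun_simplex_neg hp o hs.le
  have hTh : ∀ s, 0 < s → supportFun (T s).1 e = s := fun s hs => supportFun_simplex o hs.le
  have hTh' : ∀ s, 0 < s → supportFun (T s).1 (-e) = 0 := fun s hs =>
    supportFun_simplex_neg o hs.le
  have hIm : ∀ u, momentFun p I u = 0 := momentFun_segment (by omega) p o
  have hIh : supportFun I.1 e = 1 := supportFun_segment o
  have hIh' : supportFun I.1 (-e) = 0 := supportFun_segment_neg o
  have hg := (((hf.add (hM.const_mul (-a))).add (hM.comp_neg.const_mul (-b))).add
    (hH.const_mul (-c))).add (hH.comp_neg.const_mul (-d))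
  have hzero := hg.eq_zero hn (o := o) (fun x _ => hg.apply_smul_eq_zero hp
      (by simp only [← hI, ← he, hIm, hIh, hIh', Real.one_rpow, Real.zero_rpow hp0]; ring)
      (by simp only [← hI, ← he, hIm, hIh, hIh', neg_neg, Real.one_rpow, Real.zero_rpow hp0]; ring)
      x)
    (fun x _ => hg.apply_smul_eq_zero hp
      (by
        simp only [hT1, ← he, hTm' 1 one_pos, hTh 1 one_pos, hTh' 1 one_pos, ← hm,
          Real.one_rpow, Real.zero_rpow hp0]
        rw [ha]
        field_simp
        ring)
      (by
        simp only [hT1, ← he, hTm' 1 one_pos, hTh 1 one_pos, hTh' 1 one_pos, neg_neg, ← hm,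
          Real.one_rpow, Real.zero_rpow hp0]
        rw [hb]
        field_simp
        ring)
      x)
  have hrep : ∀ K u, f K u = a * momentFun p K u + b * momentFun p K (-u) +
      c * supportFun K.1 u ^ p + d * supportFun K.1 (-u) ^ p := fun K u => by
    have := hzero K u
    linarith
  -- Evaluation on the dilates T s, divided by s^p, gives x m s^n + y ≥ 0 for every s > 0.
  have hsign : ∀ x y : ℝ, 0 ≤ y → (∀ s : ℝ, 0 < s → 0 ≤ x * (s ^ n * s ^ p * m) + y * s ^ p) →
      0 ≤ x := by
    intro x y hy h
    refine nonneg_of_mul_nonneg_left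
      (nonneg_of_forall_pow (n := n) (by omega) hy fun s hs => ?_) hm0
    have h1 : 0 < s ^ p := Real.rpow_pos_of_pos hs p
    refine nonneg_of_mul_nonneg_left (b := s ^ p) ?_ h1
    have := h s hs
    linarith
  refine ⟨a, b, c, d, hsign a c (hf0 _ _) fun s hs => ?_, hsign b d (hf0 _ _) fun s hs => ?_,
    hf0 _ _, hf0 _ _, hrep⟩
  · have h1 := hf0 (T s) e
    rw [hrep, hTm s hs, hTm' s hs, hTh s hs, hTh' s hs, Real.zero_rpow hp0] at h1
    linarith
  · have h1 := hf0 (T s) (-e)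
    rw [hrep, neg_neg, hTm s hs, hTm' s hs, hTh s hs, hTh' s hs, Real.zero_rpow hp0] at h1
    linarith

/-- The combination of moment bodies, the body and its reflection in the classification. -/
theorem supportFun_combination {n : ℕ} {p : ℝ} (hp : 1 < p) {c₁ c₂ c₃ c₄ : ℝ} (h₁ : 0 ≤ c₁)
    (h₂ : 0 ≤ c₂) (h₃ : 0 ≤ c₃) (h₄ : 0 ≤ c₄) (K : BodyO n) (u : Euc n) :
    supportFun (lpAdd p (lpAdd p (lpAdd p (scale c₁ (momentPlus p K.1))
      (scale c₂ (momentMinus p K.1))) (scale c₃ K)) (scale c₄ (reflect K))).1 u ^ p =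
      c₁ ^ p * momentFun p K u + c₂ ^ p * momentFun p K (-u) + c₃ ^ p * supportFun K.1 u ^ p +
        c₄ ^ p * supportFun K.1 (-u) ^ p := by
  rw [supportFun_lpAdd hp, supportFun_lpAdd hp, supportFun_lpAdd hp, supportFun_scale h₁,
    supportFun_scale h₂, supportFun_scale h₃, supportFun_scale h₄,
    Real.mul_rpow h₁ (supportFun_nonneg _ _), Real.mul_rpow h₂ (supportFun_nonneg _ _),
    Real.mul_rpow h₃ (supportFun_nonneg _ _), Real.mul_rpow h₄ (supportFun_nonneg _ _),
    supportFun_momentPlus_rpow hp, supportFun_momentMinus_rpow hp, supportFun_reflect]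

end

end LpMinkowski

/-! ### The classification theorem -/

theorem mainTheorem1 (n : ℕ) (hn : 3 ≤ n) (p : ℝ) (hp : 1 < p)
    (Φ : LpMinkowski.BodyO n → LpMinkowski.BodyO n) :
    (Continuous Φ ∧ LpMinkowski.IsSLCovariant Φ ∧ LpMinkowski.IsLpMinkowskiValuation p Φ) ↔
      ∃ c₁ c₂ c₃ c₄ : ℝ, 0 ≤ c₁ ∧ 0 ≤ c₂ ∧ 0 ≤ c₃ ∧ 0 ≤ c₄ ∧
        ∀ K : LpMinkowski.BodyO n,
          Φ K = LpMinkowski.lpAdd p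
            (LpMinkowski.lpAdd p
              (LpMinkowski.lpAdd p
                (LpMinkowski.scale c₁ (LpMinkowski.momentPlus p K.1))
                (LpMinkowski.scale c₂ (LpMinkowski.momentMinus p K.1)))
              (LpMinkowski.scale c₃ K))
            (LpMinkowski.scale c₄ (LpMinkowski.reflect K)) := by
  open LpMinkowski in
  constructor
  · rintro ⟨hc, hs, hv⟩
    obtain ⟨a, b, c, d, ha, hb, hc0, hd, h⟩ :=
      (isLpFunctional_of_valuation hp hc hs hv).exists_eq hn hp
        fun K u => Real.rpow_nonneg (supportFun_nonneg _ _) _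
    -- Dilating by cᵢ multiplies the `p`-th power of the support function by cᵢ^p, so the constants
    -- are the `p`-th roots of the coefficients.
    have hroot : ∀ x : ℝ, 0 ≤ x → (x ^ (1 / p)) ^ p = x := fun x hx => by
      rw [← Real.rpow_mul hx, one_div_mul_cancel (by linarith), Real.rpow_one]
    refine ⟨a ^ (1 / p), b ^ (1 / p), c ^ (1 / p), d ^ (1 / p), Real.rpow_nonneg ha _,
      Real.rpow_nonneg hb _, Real.rpow_nonneg hc0 _, Real.rpow_nonneg hd _, fun K => ?_⟩
    refine BodyO.ext_supportFun_rpow hp fun u => ?_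
    rw [supportFun_combination hp (Real.rpow_nonneg ha _) (Real.rpow_nonneg hb _)
      (Real.rpow_nonneg hc0 _) (Real.rpow_nonneg hd _), hroot a ha, hroot b hb, hroot c hc0,
      hroot d hd]
    exact h K u
  · rintro ⟨c₁, c₂, c₃, c₄, h₁, h₂, h₃, h₄, h⟩
    have hM := isLpFunctional_momentFun (n := n) hp
    have hH := isLpFunctional_supportFun (n := n) hp
    refine valuation_of_isLpFunctional hp ?_
    simp only [h, supportFun_combination hp h₁ h₂ h₃ h₄]
    exact (((hM.const_mul _).add (hM.comp_neg.const_mul _)).add (hH.const_mul _)).add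
      (hH.comp_neg.const_mul _)
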